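/- Let $n\ge 2$, let $\Bbbk$ be an algebraically closed field of characteristic zero, let $q\in\Bbbk$ be a primitive $n$th root of unity, and fix a square root $q^{1/2}\in\Bbbk$ of $q$ (with $q^{-1/2}$ its inverse). Let $\mathsf D_n$ be the Drinfeld double of the Taft algebra at $q$: the Hopf algebra over $\Bbbk$ with generators $a,b,c,d$ and relations $$ba=qab,\quad db=qbd,\quad bc=cb,\quad ca=qac,\quad dc=qcd,\quad da-qad=1-bc,\quad a^n=0=d^n,\quad b^n=1=c^n,$$ with coproduct $\Delta(a)=a\otimes b+1\otimes a$, $\Delta(d)=d\otimes c+1\otimes d$, $\Delta(b)=b\otimes b$, $\Delta(c)=c\otimes c$ and counit $\varepsilon(a)=\varepsilon(d)=0$, $\varepsilon(b)=\varepsilon(c)=1$. Its R-matrix is $$\mathcal R=\frac1n\sum_{m,s,t=0}^{n-1}\frac{q^{-tm}}{[s]!}\,a^sb^t\otimes c^md^s,\qquad [s]!=[s][s-1]\cdots[1],\quad [m]=1+q+\cdots+q^{m-1}.$$ For $r\in\mathbb Z/n\mathbb Z$ let $\mathsf V=\mathsf V(2,r)$ be the simple $\mathsf D_n$-module with basis $v_1,v_2$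 and action $$a v_1=v_2,\ a v_2=0,\quad b v_j=q^{r+j-1}v_j,\quad c v_j=q^{j-(r+2)}v_j,\quad d v_1=0,\ d v_2=(1-q^{-1})v_1 .$$ For $k\ge 2$ let $\mathsf D_n$ act on $\mathsf V^{\otimes k}$ through the iterated coproduct, and let $\mathsf{End}_{\mathsf D_n}(\mathsf V^{\otimes k})$ be the algebra of linear endomorphisms of $\mathsf V^{\otimes k}$ that commute with this action. For $1\le i\le k-1$ let $\check{\mathsf R}_i$ be the operator on $\mathsf V^{\otimes k}$ that applies $\mathcal R$ to the tensor slots $i$ and $i+1$ and then interchanges these two factors. Set $\xi=-(q^{1/2}+q^{-1/2})$, and let $\mathsf{TL}_k(\xi)$ be the Temperley–Lieb algebra: the unital associative $\Bbbk$-algebra with generators $\mathsf t_1,\dots,\mathsf t_{k-1}$ and relations $\mathsf t_i\mathsf t_j=\mathsf t_j\mathsf t_i$ for $|i-j|>1$; $\mathsf t_i^2=\xi\,\mathsf t_i$ for $1\le i\le k-1$; and $\mathsf t_i\mathsf t_{i+1}\mathsf t_i-\mathsf t_i=\mathsf t_{i+1}\mathsf t_i\mathsf t_{i+1}-\mathsf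 t_{i+1}$ and $\mathsf t_i\mathsf t_{i+1}\mathsf t_i=\mathsf t_i$ for $1\le i\le k-2$. Then for every $r\in\mathbb Z/n\mathbb Z$ and every $k\ge 2$: (a) there is an algebra homomorphism $\pi:\mathsf{TL}_k(\xi)\to\mathsf{End}_{\mathsf D_n}(\mathsf V^{\otimes k})$ given by $\mathsf t_i\mapsto q^{1/2}\bigl(\lambda_r^{-1}\check{\mathsf R}_i-\mathsf{id}\bigr)$ for $1\le i\le k-1$, where $\lambda_r=q^{-r(r+1)}$; (b) $\pi$ is injective, that is, the action of $\mathsf{TL}_k(\xi)$ on $\mathsf V^{\otimes k}$ is faithful. -/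

import Mathlib

open scoped TensorProduct

namespace TaftTL

/-! ## Modules over a bialgebra and their tensor products

A module over a `𝕜`-algebra `H` on a `𝕜`-space `V` is an algebra homomorphism
`H →ₐ[𝕜] Module.End 𝕜 V`. -/

section Bialgebra

variable {𝕜 H V W : Type*} [Field 𝕜] [Ring H] [Bialgebra 𝕜 H]
  [AddCommGroup V] [Module 𝕜 V] [AddCommGroup W] [Module 𝕜 W]

/-- The tensor product of two `H`-modules: `x` acts as `∑ x₍₁₎ ⊗ x₍₂₎`. -/
noncomputable def tensorRep (ρ : H →ₐ[𝕜] Module.End 𝕜 V) (τ : H →ₐ[𝕜] Module.End 𝕜 W) :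
    H →ₐ[𝕜] Module.End 𝕜 (V ⊗[𝕜] W) :=
  ((Module.endTensorEndAlgHom (R := 𝕜) (S := 𝕜) (A := 𝕜) (M := V) (N := W)).comp
    (Algebra.TensorProduct.map ρ τ)).comp (Bialgebra.comulAlgHom 𝕜 H)

/-- The identification `V^{⊗k} ⊗ V = V^{⊗(k+1)}`. -/
noncomputable def snocEquiv (𝕜 V : Type*) [Field 𝕜] [AddCommGroup V] [Module 𝕜 V] (k : ℕ) :
    (TensorPower 𝕜 k V) ⊗[𝕜] V ≃ₗ[𝕜] TensorPower 𝕜 (k + 1) V :=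
  (TensorProduct.congr (LinearEquiv.refl 𝕜 _)
    (PiTensorProduct.subsingletonEquiv (R := 𝕜) (s := fun _ : Fin 1 => V) 0).symm).trans
    (TensorPower.mulEquiv (R := 𝕜) (M := V) (n := k) (m := 1))

/-- The `H`-module `V^{⊗k}`: the trivial module (through the counit) for `k = 0`, and
`V^{⊗(k+1)} = V^{⊗k} ⊗ V`. -/
noncomputable def powRep (ρ : H →ₐ[𝕜] Module.End 𝕜 V) :
    (k : ℕ) → H →ₐ[𝕜] Module.End 𝕜 (TensorPower 𝕜 k V)
  | 0 => (Algebra.ofId 𝕜 _).comp (Bialgebra.counitAlgHom 𝕜 H)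
  | k + 1 => ((snocEquiv 𝕜 V k).conjAlgEquiv 𝕜).toAlgHom.comp (tensorRep (powRep ρ k) ρ)

/-- `End_H(V)`: the algebra of linear endomorphisms that commute with the action of `H`. -/
def endAlg (ρ : H →ₐ[𝕜] Module.End 𝕜 V) : Subalgebra 𝕜 (Module.End 𝕜 V) :=
  Subalgebra.centralizer 𝕜 (Set.range ρ)

end Bialgebra

section Slots

variable {𝕜 H V : Type*} [Field 𝕜] [Ring H] [Algebra 𝕜 H] [AddCommGroup V] [Module 𝕜 V]

/-- `slot k i f = id ⊗ ⋯ ⊗ f ⊗ ⋯ ⊗ id` on `V^{⊗k}`, with `f` in slot `i`. -/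
noncomputable def slot (k : ℕ) (i : Fin k) :
    Module.End 𝕜 V →ₗ[𝕜] Module.End 𝕜 (TensorPower 𝕜 k V) :=
  (PiTensorProduct.mapMultilinear 𝕜 (fun _ : Fin k => V) (fun _ => V)).toLinearMap
    (fun _ => LinearMap.id) i

/-- The action of `R = ∑ x ⊗ y` in `H ⊗ H` on `V^{⊗k}` with `x` acting in slot `i` and `y` acting
in slot `j` (for `i ≠ j`). -/
noncomputable def actSlots (ρ : H →ₐ[𝕜] Module.End 𝕜 V) (k : ℕ) (i j : Fin k) (R : H ⊗[𝕜] H) :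
    Module.End 𝕜 (TensorPower 𝕜 k V) :=
  LinearMap.mul' 𝕜 (Module.End 𝕜 (TensorPower 𝕜 k V))
    (TensorProduct.map (slot k i ∘ₗ ρ.toLinearMap) (slot k j ∘ₗ ρ.toLinearMap) R)

/-- The interchange of the tensor factors `i` and `j` of `V^{⊗k}`. -/
noncomputable def swapSlots (𝕜 V : Type*) [Field 𝕜] [AddCommGroup V] [Module 𝕜 V]
    (k : ℕ) (i j : Fin k) : Module.End 𝕜 (TensorPower 𝕜 k V) :=
  (PiTensorProduct.reindex 𝕜 (fun _ : Fin k => V) (Equiv.swap i j)).toLinearMap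

/-- The operator `Ř_{i+1}` on `V^{⊗k}` (`i` counts from `0`): apply `R` to the tensor slots `i` and
`i + 1` and then interchange these two factors. -/
noncomputable def checkR (ρ : H →ₐ[𝕜] Module.End 𝕜 V) (R : H ⊗[𝕜] H) (k : ℕ) (i : Fin (k - 1)) :
    Module.End 𝕜 (TensorPower 𝕜 k V) :=
  let i₀ : Fin k := ⟨i, by omega⟩
  let i₁ : Fin k := ⟨i + 1, by omega⟩
  swapSlots 𝕜 V k i₀ i₁ * actSlots ρ k i₀ i₁ R

end Slots

/-! ## The Temperley-Lieb algebra -/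

/-- The defining relations of the Temperley-Lieb algebra on generators `t_i`, `i < k - 1`. -/
inductive TLRel {𝕜 : Type*} [Field 𝕜] (k : ℕ) (ξ : 𝕜) :
    FreeAlgebra 𝕜 (Fin (k - 1)) → FreeAlgebra 𝕜 (Fin (k - 1)) → Prop
  | comm (i j : Fin (k - 1)) (h : (i : ℕ) + 1 < j ∨ (j : ℕ) + 1 < i) :
      TLRel k ξ (FreeAlgebra.ι 𝕜 i * FreeAlgebra.ι 𝕜 j) (FreeAlgebra.ι 𝕜 j * FreeAlgebra.ι 𝕜 i)
  | braid (i j : Fin (k - 1)) (h : (j : ℕ) = i + 1) :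
      TLRel k ξ
        (FreeAlgebra.ι 𝕜 i * FreeAlgebra.ι 𝕜 j * FreeAlgebra.ι 𝕜 i - FreeAlgebra.ι 𝕜 i)
        (FreeAlgebra.ι 𝕜 j * FreeAlgebra.ι 𝕜 i * FreeAlgebra.ι 𝕜 j - FreeAlgebra.ι 𝕜 j)
  | sq (i : Fin (k - 1)) :
      TLRel k ξ (FreeAlgebra.ι 𝕜 i * FreeAlgebra.ι 𝕜 i) (ξ • FreeAlgebra.ι 𝕜 i)
  | triple (i j : Fin (k - 1)) (h : (j : ℕ) = i + 1) :
      TLRel k ξ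
        (FreeAlgebra.ι 𝕜 i * FreeAlgebra.ι 𝕜 j * FreeAlgebra.ι 𝕜 i) (FreeAlgebra.ι 𝕜 i)

/-- The Temperley-Lieb algebra `TL_k(ξ)`. -/
abbrev TL {𝕜 : Type*} [Field 𝕜] (k : ℕ) (ξ : 𝕜) : Type _ := RingQuot (TLRel k ξ)

/-- The generators `t_{i+1}` of `TL_k(ξ)` (`i` counts from `0`). -/
noncomputable def TL.t {𝕜 : Type*} [Field 𝕜] (k : ℕ) (ξ : 𝕜) (i : Fin (k - 1)) : TL k ξ :=
  RingQuot.mkAlgHom 𝕜 (TLRel k ξ) (FreeAlgebra.ι 𝕜 i)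

/-! ## The Drinfeld double of the Taft algebra -/

/-- The four generators of the double. -/
inductive Gen | a | b | c | d

/-- The defining relations of the Drinfeld double `D_n` of the Taft algebra. -/
inductive DRel {𝕜 : Type*} [Field 𝕜] (n : ℕ) (q : 𝕜) :
    FreeAlgebra 𝕜 Gen → FreeAlgebra 𝕜 Gen → Prop
  | ba : DRel n q (.ι 𝕜 .b * .ι 𝕜 .a) (q • (.ι 𝕜 .a * .ι 𝕜 .b))
  | db : DRel n q (.ι 𝕜 .d * .ι 𝕜 .b) (q • (.ι 𝕜 .b * .ι 𝕜 .d))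
  | bc : DRel n q (.ι 𝕜 .b * .ι 𝕜 .c) (.ι 𝕜 .c * .ι 𝕜 .b)
  | ca : DRel n q (.ι 𝕜 .c * .ι 𝕜 .a) (q • (.ι 𝕜 .a * .ι 𝕜 .c))
  | dc : DRel n q (.ι 𝕜 .d * .ι 𝕜 .c) (q • (.ι 𝕜 .c * .ι 𝕜 .d))
  | da : DRel n q (.ι 𝕜 .d * .ι 𝕜 .a - q • (.ι 𝕜 .a * .ι 𝕜 .d)) (1 - .ι 𝕜 .b * .ι 𝕜 .c)
  | an : DRel n q (.ι 𝕜 .a ^ n) 0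
  | dn : DRel n q (.ι 𝕜 .d ^ n) 0
  | bn : DRel n q (.ι 𝕜 .b ^ n) 1
  | cn : DRel n q (.ι 𝕜 .c ^ n) 1

/-- The Drinfeld double `D_n` of the Taft algebra at the primitive `n`-th root of unity `q`. The
root of unity is recorded in the type so that the bialgebra structure below can be an instance. -/
def D {𝕜 : Type*} [Field 𝕜] {n : ℕ} {q : 𝕜} (_hq : IsPrimitiveRoot q n) : Type _ :=
  RingQuot (DRel n q)

namespace D

variable {𝕜 : Type*} [Field 𝕜] {n : ℕ} {q : 𝕜} (hq : IsPrimitiveRoot q n)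

noncomputable instance : Ring (D hq) := inferInstanceAs (Ring (RingQuot (DRel n q)))
noncomputable instance : Algebra 𝕜 (D hq) := inferInstanceAs (Algebra 𝕜 (RingQuot (DRel n q)))

/-- The generators of `D_n`. -/
noncomputable def gen (x : Gen) : D hq := RingQuot.mkAlgHom 𝕜 (DRel n q) (.ι 𝕜 x)

/-- The relations of `D_n` for four elements of an algebra `A`, as needed to define a
homomorphism out of `D_n`. -/
structure Sat {A : Type*} [Ring A] [Algebra 𝕜 A] (n : ℕ) (q : 𝕜) (f : Gen → A) : Prop where
  ba : f .b * f .a = q • (f .a * f .b)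
  db : f .d * f .b = q • (f .b * f .d)
  bc : f .b * f .c = f .c * f .b
  ca : f .c * f .a = q • (f .a * f .c)
  dc : f .d * f .c = q • (f .c * f .d)
  da : f .d * f .a - q • (f .a * f .d) = 1 - f .b * f .c
  an : f .a ^ n = 0
  dn : f .d ^ n = 0
  bn : f .b ^ n = 1
  cn : f .c ^ n = 1

/-- The universal property of `D_n`. -/
noncomputable def lift {A : Type*} [Ring A] [Algebra 𝕜 A] (f : Gen → A) (hf : Sat n q f) :
    D hq →ₐ[𝕜] A :=
  RingQuot.liftAlgHom 𝕜 (s := DRel n q) ⟨FreeAlgebra.lift 𝕜 f, by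
    intro x y h
    cases h <;> simp [hf.ba, hf.db, hf.bc, hf.ca, hf.dc, hf.da, hf.an, hf.dn, hf.bn, hf.cn]⟩

@[simp] theorem lift_gen {A : Type*} [Ring A] [Algebra 𝕜 A] (f : Gen → A) (hf : Sat n q f)
    (x : Gen) : lift hq f hf (gen hq x) = f x := by
  unfold lift gen
  erw [RingQuot.liftAlgHom_mkAlgHom_apply]
  simp

theorem algHom_ext {A : Type*} [Ring A] [Algebra 𝕜 A] {φ ψ : D hq →ₐ[𝕜] A}
    (h : ∀ x, φ (gen hq x) = ψ (gen hq x)) : φ = ψ := by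
  apply RingQuot.ringQuot_ext' (S := 𝕜) (s := DRel n q)
  apply FreeAlgebra.hom_ext
  funext x
  exact h x

theorem sat_gen : Sat n q (gen hq) := by
  let π : FreeAlgebra 𝕜 Gen →ₐ[𝕜] D hq := RingQuot.mkAlgHom 𝕜 (DRel n q)
  have key : ∀ {x y}, DRel n q x y → π x = π y := fun h => RingQuot.mkAlgHom_rel 𝕜 h
  have hg : ∀ x, π (.ι 𝕜 x) = gen hq x := fun _ => rfl
  constructor
  · simpa [hg] using key .ba
  · simpa [hg] using key .db
  · simpa [hg] using key .bc
  · simpa [hg] using key .ca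
  · simpa [hg] using key .dc
  · simpa [hg] using key .da
  · simpa [hg] using key .an
  · simpa [hg] using key .dn
  · simpa [hg] using key .bn
  · simpa [hg] using key .cn

end D

/-! ### The `q`-binomial theorem at a root of unity -/

section QBinomial

variable {𝕜 : Type*} [Field 𝕜]

/-- Gaussian binomial coefficients, by their recursion. -/
def gauss (q : 𝕜) : ℕ → ℕ → 𝕜
  | _, 0 => 1
  | 0, _ + 1 => 0
  | m + 1, i + 1 => q ^ (i + 1) * gauss q m (i + 1) + gauss q m i

theorem gauss_zero (q : 𝕜) (m : ℕ) : gauss q m 0 = 1 := by cases m <;> rfl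

theorem gauss_absorb (q : 𝕜) (m : ℕ) : ∀ i, (1 - q ^ (i + 1)) * gauss q (m + 1) (i + 1) =
    (1 - q ^ (m + 1)) * gauss q m i := by
  induction m with
  | zero =>
    intro i
    cases i <;> simp [gauss]
  | succ m ih =>
    intro i
    have h1 := ih i
    have e : gauss q (m + 1 + 1) (i + 1) =
      q ^ (i + 1) * gauss q (m + 1) (i + 1) + gauss q (m + 1) i := rfl
    rw [e]
    cases i with
    | zero =>
      rw [gauss_zero] at *
      linear_combination q * h1
    | succ i =>
      have h2 := ih i
      have e2 : gauss q (m + 1) (i + 1) = q ^ (i + 1) * gauss q m (i + 1) + gauss q m i := rfl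
      linear_combination q ^ (i + 2) * h1 - q * (1 - q ^ (m + 1)) * e2 + q * h2

theorem gauss_eq_zero {q : 𝕜} {n : ℕ} (hq : IsPrimitiveRoot q n) {i : ℕ} (h0 : 0 < i)
    (hi : i < n) : gauss q n i = 0 := by
  obtain ⟨i, rfl⟩ : ∃ j, i = j + 1 := ⟨i - 1, by omega⟩
  obtain ⟨m, rfl⟩ : ∃ j, n = j + 1 := ⟨n - 1, by omega⟩
  have h := gauss_absorb q m i
  rw [hq.pow_eq_one, sub_self, zero_mul] at h
  refine (mul_eq_zero.mp h).resolve_left fun h' => ?_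
  exact hq.pow_ne_one_of_pos_of_lt (by omega) hi (sub_eq_zero.mp h').symm

variable {A : Type*} [Ring A] [Algebra 𝕜 A]

theorem gauss_of_lt (q : 𝕜) (m : ℕ) : ∀ i, m < i → gauss q m i = 0 := by
  induction m with
  | zero => intro i hi; cases i <;> simp_all [gauss]
  | succ m ih =>
    intro i hi
    cases i with
    | zero => omega
    | succ i => simp [gauss, ih i (by omega), ih (i + 1) (by omega)]

theorem add_pow_gauss {q : 𝕜} {x y : A} (h : x * y = q • (y * x)) (m : ℕ) :
    (x + y) ^ m = ∑ i ∈ Finset.range (m + 1), gauss q m i • (y ^ i * x ^ (m - i)) := by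
  have hxy : ∀ i, x * y ^ i = q ^ i • (y ^ i * x) := by
    intro i
    induction i with
    | zero => simp
    | succ i ih =>
      rw [pow_succ, ← mul_assoc, ih, smul_mul_assoc, mul_assoc, h, mul_smul_comm, smul_smul,
        ← pow_succ, mul_assoc]
  induction m with
  | zero => simp [gauss]
  | succ m ih =>
    have hx : x * (x + y) ^ m = ∑ i ∈ Finset.range (m + 1 + 1),
        (q ^ i * gauss q m i) • (y ^ i * x ^ (m + 1 - i)) := by
      rw [Finset.sum_range_succ, gauss_of_lt q m (m + 1) (by omega), mul_zero, zero_smul, add_zero,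
        ih, Finset.mul_sum]
      refine Finset.sum_congr rfl fun i hi => ?_
      rw [Finset.mem_range] at hi
      rw [mul_smul_comm, ← mul_assoc, hxy, smul_mul_assoc, smul_smul, mul_assoc, ← pow_succ',
        mul_comm (gauss q m i), show m - i + 1 = m + 1 - i by omega]
    have hy : y * (x + y) ^ m = ∑ i ∈ Finset.range (m + 1),
        gauss q m i • (y ^ (i + 1) * x ^ (m + 1 - (i + 1))) := by
      rw [ih, Finset.mul_sum]
      refine Finset.sum_congr rfl fun i hi => ?_
      rw [mul_smul_comm, ← mul_assoc, ← pow_succ', Nat.add_sub_add_right]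
    rw [pow_succ', add_mul, hx, hy, Finset.sum_range_succ', Finset.sum_range_succ' (n := m + 1),
      add_right_comm, ← Finset.sum_add_distrib]
    congr 1
    · refine Finset.sum_congr rfl fun i _ => ?_
      rw [← add_smul]
      rfl
    · simp [gauss_zero]

theorem add_pow_eq_zero {q : 𝕜} {n : ℕ} (hq : IsPrimitiveRoot q n) {x y : A}
    (h : x * y = q • (y * x)) (hx : x ^ n = 0) (hy : y ^ n = 0) : (x + y) ^ n = 0 := by
  rw [add_pow_gauss h]
  refine Finset.sum_eq_zero fun i hi => ?_
  rw [Finset.mem_range] at hi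
  rcases Nat.eq_zero_or_pos i with rfl | h0
  · simp [hx]
  · rcases Nat.lt_or_ge i n with h1 | h1
    · rw [gauss_eq_zero hq h0 h1, zero_smul]
    · obtain rfl : i = n := by omega
      simp [hy]

end QBinomial

namespace D

variable {𝕜 : Type*} [Field 𝕜] {n : ℕ} {q : 𝕜} (hq : IsPrimitiveRoot q n)

/-- The coproduct on the generators:
`Δ a = a ⊗ b + 1 ⊗ a`, `Δ b = b ⊗ b`, `Δ c = c ⊗ c`, `Δ d = d ⊗ c + 1 ⊗ d`. -/
noncomputable def comulGen : Gen → D hq ⊗[𝕜] D hq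
  | .a => gen hq .a ⊗ₜ gen hq .b + 1 ⊗ₜ gen hq .a
  | .b => gen hq .b ⊗ₜ gen hq .b
  | .c => gen hq .c ⊗ₜ gen hq .c
  | .d => gen hq .d ⊗ₜ gen hq .c + 1 ⊗ₜ gen hq .d

theorem sat_comulGen : Sat n q (comulGen hq) := by
  have h := sat_gen hq
  have hba := h.ba
  have hdb := h.db
  have hbc := h.bc
  have hca := h.ca
  have hdc := h.dc
  have hda := h.da
  constructor
  · simp only [comulGen, mul_add, add_mul, Algebra.TensorProduct.tmul_mul_tmul, one_mul, mul_one,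
      hba, smul_add, TensorProduct.smul_tmul', TensorProduct.tmul_smul]
  · simp only [comulGen, mul_add, add_mul, Algebra.TensorProduct.tmul_mul_tmul, one_mul, mul_one,
      hdb, hbc, smul_add, TensorProduct.smul_tmul', TensorProduct.tmul_smul]
  · simp only [comulGen, Algebra.TensorProduct.tmul_mul_tmul, hbc]
  · simp only [comulGen, mul_add, add_mul, Algebra.TensorProduct.tmul_mul_tmul, one_mul, mul_one,
      hca, hbc, smul_add, TensorProduct.smul_tmul', TensorProduct.tmul_smul]
  · simp only [comulGen, mul_add, add_mul, Algebra.TensorProduct.tmul_mul_tmul, one_mul, mul_one,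
      hdc, smul_add, TensorProduct.smul_tmul', TensorProduct.tmul_smul]
  · have hda' : gen hq .d * gen hq .a = q • (gen hq .a * gen hq .d) + (1 - gen hq .b * gen hq .c) :=
      by rw [← hda]; abel
    simp only [comulGen, mul_add, add_mul, Algebra.TensorProduct.tmul_mul_tmul, one_mul, mul_one,
      hda', hca, hdb, ← hbc, smul_add, TensorProduct.smul_tmul', TensorProduct.tmul_smul,
      TensorProduct.add_tmul, TensorProduct.tmul_add, TensorProduct.sub_tmul,
      TensorProduct.tmul_sub, Algebra.TensorProduct.one_def]
    abel
  · refine add_pow_eq_zero hq ?_ ?_ ?_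
    · simp only [Algebra.TensorProduct.tmul_mul_tmul, one_mul, mul_one, hba,
        TensorProduct.tmul_smul]
    · rw [Algebra.TensorProduct.tmul_pow, h.an, TensorProduct.zero_tmul]
    · rw [Algebra.TensorProduct.tmul_pow, h.an, TensorProduct.tmul_zero]
  · rw [comulGen, add_comm]
    refine add_pow_eq_zero hq ?_ ?_ ?_
    · simp only [Algebra.TensorProduct.tmul_mul_tmul, one_mul, mul_one, hdc,
        TensorProduct.tmul_smul]
    · rw [Algebra.TensorProduct.tmul_pow, h.dn, TensorProduct.tmul_zero]
    · rw [Algebra.TensorProduct.tmul_pow, h.dn, TensorProduct.zero_tmul]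
  · rw [comulGen, Algebra.TensorProduct.tmul_pow, h.bn, Algebra.TensorProduct.one_def]
  · rw [comulGen, Algebra.TensorProduct.tmul_pow, h.cn, Algebra.TensorProduct.one_def]

/-- The counit on the generators: `ε a = ε d = 0` and `ε b = ε c = 1`. -/
def counitGen (𝕜 : Type*) [Field 𝕜] : Gen → 𝕜
  | .a => 0
  | .b => 1
  | .c => 1
  | .d => 0

theorem sat_counitGen [n.AtLeastTwo] : Sat n q (counitGen 𝕜) := by
  constructor <;> simp [counitGen, NeZero.ne n]

/-- The bialgebra structure of `D_n`. (The antipode is determined by it and plays no role below.) -/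
noncomputable instance [n.AtLeastTwo] : Bialgebra 𝕜 (D hq) :=
  Bialgebra.ofAlgHom (lift hq (comulGen hq) (sat_comulGen hq))
    (lift hq (counitGen 𝕜) sat_counitGen)
    (by
      apply algHom_ext
      rintro (_ | _ | _ | _) <;>
        simp [comulGen, TensorProduct.tmul_add, TensorProduct.add_tmul,
          Algebra.TensorProduct.one_def, add_assoc])
    (by
      apply algHom_ext
      rintro (_ | _ | _ | _) <;> simp [comulGen, counitGen])
    (by
      apply algHom_ext
      rintro (_ | _ | _ | _) <;> simp [comulGen, counitGen])

end D

/-! ### The simple modules `V(2, r)` -/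

section Module

variable {𝕜 : Type*} [Field 𝕜] {n : ℕ} {q : 𝕜} (hq : IsPrimitiveRoot q n)

/-- `q ^ x` for an exponent `x` modulo `n`, where `q ^ n = 1`. -/
def qpow {n : ℕ} (q : 𝕜) (x : ZMod n) : 𝕜 := q ^ x.val

/-- The matrices of the generators on `V(2, r)` in the basis `v₁, v₂`. -/
def matGen (q : 𝕜) (r : ZMod n) : Gen → Matrix (Fin 2) (Fin 2) 𝕜
  | .a => !![0, 0; 1, 0]
  | .b => !![qpow q r, 0; 0, qpow q (r + 1)]
  | .c => !![qpow q (-(r + 1)), 0; 0, qpow q (-r)]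
  | .d => !![0, 1 - q⁻¹; 0, 0]

theorem qpow_add [n.AtLeastTwo] (hq : IsPrimitiveRoot q n) (x y : ZMod n) :
    qpow q (x + y) = qpow q x * qpow q y := by
  rw [qpow, qpow, qpow, ZMod.val_add, ← pow_add, ← pow_eq_pow_mod _ hq.pow_eq_one]

theorem qpow_one [n.AtLeastTwo] : qpow q (1 : ZMod n) = q := by
  have : Fact (1 < n) := ⟨Nat.AtLeastTwo.one_lt⟩
  rw [qpow, ZMod.val_one, pow_one]

theorem qpow_zero [n.AtLeastTwo] : qpow q (0 : ZMod n) = 1 := by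
  rw [qpow, ZMod.val_zero, pow_zero]

theorem qpow_pow (hq : IsPrimitiveRoot q n) (x : ZMod n) : qpow q x ^ n = 1 := by
  rw [qpow, ← pow_mul, mul_comm, pow_mul, hq.pow_eq_one, one_pow]

theorem sat_matGen [n.AtLeastTwo] (hq : IsPrimitiveRoot q n) (r : ZMod n) :
    D.Sat n q (matGen q r) := by
  have q0 : q ≠ 0 := hq.ne_zero (NeZero.ne n)
  have h1 : qpow q (r + 1) = qpow q r * q := by rw [qpow_add hq, qpow_one]
  have h2 : qpow q (-r) = qpow q (-(r + 1)) * q := by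
    rw [show -r = -(r + 1) + 1 by ring, qpow_add hq, qpow_one]
  have h3 : qpow q r * qpow q (-(r + 1)) * q = 1 := by
    rw [mul_assoc, ← h2, ← qpow_add hq, add_neg_cancel, qpow_zero]
  have h3' : qpow q r * qpow q (-(r + 1)) = q⁻¹ := eq_inv_of_mul_eq_one_left h3
  have hn : 2 ≤ n := Nat.AtLeastTwo.prop
  have hd : ∀ x y : 𝕜, (!![x, 0; 0, y] : Matrix (Fin 2) (Fin 2) 𝕜) ^ n = !![x ^ n, 0; 0, y ^ n] := by
    intro x y
    have e : ∀ x y : 𝕜, (!![x, 0; 0, y] : Matrix (Fin 2) (Fin 2) 𝕜) = Matrix.diagonal ![x, y] := by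
      intro x y
      ext i j
      fin_cases i <;> fin_cases j <;> simp
    rw [e, Matrix.diagonal_pow, e]
    congr 1
    ext i
    fin_cases i <;> simp
  generalize ha : qpow q r = x at *
  generalize hb : qpow q (-(r + 1)) = y at *
  constructor
  · simp [matGen, ha, h1, mul_comm]
  · simp only [matGen, ha, h1]
    ext i j
    fin_cases i <;> fin_cases j <;> simp
    ring
  · simp [matGen, mul_comm]
  · simp only [matGen, hb, h2]
    simp [mul_comm]
  · simp only [matGen, hb, h2]
    ext i j
    fin_cases i <;> fin_cases j <;> simp
    ring
  · simp only [matGen, ha, hb, h1, h2]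
    ext i j
    fin_cases i <;> fin_cases j <;> simp
    · exact h3'.symm
    · field_simp
      linear_combination q * h3
  · exact pow_eq_zero_of_le hn
      (by ext i j; fin_cases i <;> fin_cases j <;> simp [matGen, pow_two])
  · exact pow_eq_zero_of_le hn
      (by ext i j; fin_cases i <;> fin_cases j <;> simp [matGen, pow_two])
  · simp only [matGen, hd, qpow_pow hq, Matrix.one_fin_two]
  · simp only [matGen, hd, qpow_pow hq, Matrix.one_fin_two]

/-- The two-dimensional simple `D_n`-module `V(2, r)`, on `𝕜²` with its standard basis
`v₁, v₂`. -/
noncomputable def V2 [n.AtLeastTwo] (hq : IsPrimitiveRoot q n) (r : ZMod n) :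
    D hq →ₐ[𝕜] Module.End 𝕜 (Fin 2 → 𝕜) :=
  (Matrix.toLinAlgEquiv' (R := 𝕜) (n := Fin 2)).toAlgHom.comp
    (D.lift hq (matGen q r) (sat_matGen hq r))

end Module

/-! ### The R-matrix -/

section RMatrix

variable {𝕜 : Type*} [Field 𝕜]

/-- The quantum factorial `[s]! = [s] ⋯ [1]`, where `[m] = 1 + q + ⋯ + q^(m-1)`. -/
def qFactorial (q : 𝕜) (s : ℕ) : 𝕜 :=
  ∏ m ∈ Finset.range s, ∑ i ∈ Finset.range (m + 1), q ^ i

/-- The R-matrix of `D_n`,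
`(1 / n) ∑_{m, s, t = 0}^{n - 1} (q ^ (-t m) / [s]!) a^s b^t ⊗ c^m d^s`. -/
noncomputable def Rmatrix {n : ℕ} {q : 𝕜} (hq : IsPrimitiveRoot q n) : D hq ⊗[𝕜] D hq :=
  (1 / (n : 𝕜)) • ∑ m ∈ Finset.range n, ∑ s ∈ Finset.range n, ∑ t ∈ Finset.range n,
    (q ^ (-((t : ℤ) * m)) / qFactorial q s) •
      ((D.gen hq .a ^ s * D.gen hq .b ^ t) ⊗ₜ[𝕜] (D.gen hq .c ^ m * D.gen hq .d ^ s))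

end RMatrix

end TaftTL

namespace TaftTL


/-! Expand tensors in the basis $v_{y_1}\otimes\cdots\otimes v_{y_k}$, so that $V^{\otimes k}$
becomes the space of functions of $k$ two-valued spins (spin 0 for $v_1$, spin 1 for $v_2$). There
$t_i$ becomes `adjSite`: it kills configurations with equal spins at the two sites, and on unequal
spins it is a $2\times2$ matrix with diagonal weights $A$ and exchange weights $B$, where
$A_0A_1=B_0B_1=1$ (`coords_checkR`). These two equations alone give the Temperley–Lieb relations
with parameter $A_0+A_1$, here $-p^{-1}-p=\xi$ (`tlSat_adjSite`), hence the homomorphism. Its image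
commutes with $\mathsf D_n$ because each generator is skew-primitive or grouplike, which reduces the
claim to a computation on two tensor factors (`adjSite_comm_coordRep`).

Faithfulness compares a spanning set with its image. The relations rewrite every word as a multiple
of a Jones normal form, a product of increasing runs $t_jt_{j+1}\cdots t_i$ whose first and last
indices both decrease strictly (`TLSat.wordProd_mem_span`). The images of the normal forms are
linearly independent (`linearIndependent_jones`). Read the spins equal to 1 as particles: a letter
leaves its particle in place or moves it by one site, so a word of length $l$ raises the sum of the
positions by at most $l$, and by exactly $l$ only if every letter moves a particle up. A normal form
with pairs $(i,j)$ carries the particles from the set of all $j$ to the set of all $i+1$ in this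
extremal way, with entry a power of $B_1$. These two sets determine the normal form, so ordering by
length and then by number of particles makes the matrix of entries triangular with nonzero diagonal.

Nothing here depends on the value of $\xi$, so semisimplicity of the algebra plays no role. -/

/-! ### Jones normal forms -/

section NormalForm

/-- Lists of pairs `(i, j)` with `j ≤ i`, strictly decreasing in both entries. -/
def IsJones : List (ℕ × ℕ) → Prop
  | [] => True
  | x :: L => x.2 ≤ x.1 ∧ (∀ y ∈ L, y.1 < x.1 ∧ y.2 < x.2) ∧ IsJones L

/-- The word `j, j + 1, …, i` for each pair `(i, j)`, concatenated. -/
def jonesWord : List (ℕ × ℕ) → List ℕ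
  | [] => []
  | x :: L => List.range' x.2 (x.1 + 1 - x.2) ++ jonesWord L

theorem mem_jonesWord {L : List (ℕ × ℕ)} {a : ℕ} :
    a ∈ jonesWord L ↔ ∃ x ∈ L, x.2 ≤ a ∧ a ≤ x.1 := by
  induction L with
  | nil => simp [jonesWord]
  | cons x L ih =>
    simp only [jonesWord, List.mem_append, List.mem_range'_1, ih, List.mem_cons, exists_eq_or_imp]
    refine or_congr_left ?_
    omega

theorem IsJones.snd_le_fst {L : List (ℕ × ℕ)} (h : IsJones L) : ∀ x ∈ L, x.2 ≤ x.1 := by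
  induction L with
  | nil => simp
  | cons y L ih => simpa using ⟨h.1, fun a b hab => ih h.2.2 _ hab⟩

variable {𝕜 A : Type*} [Field 𝕜] [Ring A] [Algebra 𝕜 A]

/-- The product of the word `w` in the elements `f`. -/
def wordProd (f : ℕ → A) (w : List ℕ) : A := (w.map f).prod

@[simp] theorem wordProd_nil (f : ℕ → A) : wordProd f [] = 1 := rfl

@[simp] theorem wordProd_cons (f : ℕ → A) (a : ℕ) (w : List ℕ) :
    wordProd f (a :: w) = f a * wordProd f w := by simp [wordProd]

@[simp] theorem wordProd_append (f : ℕ → A) (v w : List ℕ) :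
    wordProd f (v ++ w) = wordProd f v * wordProd f w := by simp [wordProd]

/-- The Temperley-Lieb relations for `f 0, …, f (N - 1)`. -/
structure TLSat (ξ : 𝕜) (N : ℕ) (f : ℕ → A) : Prop where
  comm : ∀ a b, a + 1 < b → f a * f b = f b * f a
  sq : ∀ a, f a * f a = ξ • f a
  up : ∀ a, a + 1 < N → f a * f (a + 1) * f a = f a
  down : ∀ a, a + 1 < N → f (a + 1) * f a * f (a + 1) = f (a + 1)

/-- `x` is a multiple of a word of length less than `l` in the letters `0, …, N - 1`. -/
def IsShort (𝕜 : Type*) [Field 𝕜] [Algebra 𝕜 A] (f : ℕ → A) (N l : ℕ) (x : A) : Prop :=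
  ∃ (c : 𝕜) (w : List ℕ), w.length < l ∧ (∀ a ∈ w, a < N) ∧ x = c • wordProd f w

variable {ξ : 𝕜} {N : ℕ} {f : ℕ → A}

theorem TLSat.comm_wordProd (h : TLSat ξ N f) {m : ℕ} {w : List ℕ} (hw : ∀ a ∈ w, m + 1 < a) :
    f m * wordProd f w = wordProd f w * f m := by
  induction w with
  | nil => simp
  | cons a w ih =>
    simp only [List.mem_cons, forall_eq_or_imp] at hw
    rw [wordProd_cons, ← mul_assoc, h.comm m a hw.1, mul_assoc, ih hw.2, mul_assoc]

theorem TLSat.comm_wordProd' (h : TLSat ξ N f) {m : ℕ} {w : List ℕ} (hw : ∀ a ∈ w, a + 1 < m) :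
    f m * wordProd f w = wordProd f w * f m := by
  induction w with
  | nil => simp
  | cons a w ih =>
    simp only [List.mem_cons, forall_eq_or_imp] at hw
    rw [wordProd_cons, ← mul_assoc, ← h.comm a m hw.1, mul_assoc, ih hw.2, mul_assoc]

theorem range'_eq_cons {j i : ℕ} (h : j ≤ i) :
    List.range' j (i + 1 - j) = j :: List.range' (j + 1) (i + 1 - (j + 1)) := by
  rw [show i + 1 - j = (i + 1 - (j + 1)) + 1 by omega, List.range'_succ]

/-- A generator times a normal form is a normal form of length one more, or a multiple of a shorter
word. -/
theorem TLSat.mul_jones (h : TLSat ξ N f) {m : ℕ} (hm : m < N) (L : List (ℕ × ℕ))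
    (hL : IsJones L) (hN : ∀ x ∈ L, x.1 < N) :
    IsShort 𝕜 f N ((jonesWord L).length + 1) (f m * wordProd f (jonesWord L)) ∨
    ∃ L', IsJones L' ∧ (jonesWord L').length = (jonesWord L).length + 1 ∧
      wordProd f (jonesWord L') = f m * wordProd f (jonesWord L) ∧
      ∀ u v, (∀ x ∈ L, x.1 < u ∧ x.2 < v) → m < u → m < v → ∀ x ∈ L', x.1 < u ∧ x.2 < v := by
  induction L with
  | nil => exact Or.inr ⟨[(m, m)], by simp [IsJones], by simp [jonesWord], by simp [jonesWord],
      fun u v _ hu hv => by simp [hu, hv]⟩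
  | cons x L ih =>
    obtain ⟨i, j⟩ := x
    obtain ⟨hji, hlt, hL'⟩ := hL
    simp only [List.mem_cons, forall_eq_or_imp] at hN hji hlt
    obtain ⟨hiN, hN⟩ := hN
    have hwN : ∀ a ∈ jonesWord L, a < N := by
      intro a ha
      obtain ⟨x, hx, h1, h2⟩ := mem_jonesWord.mp ha
      have := hN x hx
      omega
    rcases lt_or_ge i m with him | him
    · refine Or.inr ⟨(m, m) :: (i, j) :: L, ⟨le_rfl, ?_, hji, hlt, hL'⟩, ?_, ?_, ?_⟩
      · simp only [List.mem_cons, forall_eq_or_imp]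
        refine ⟨by omega, fun y hy => ?_⟩
        have := hlt y hy
        omega
      · simp [jonesWord]
      · simp [jonesWord]
      · intro u v hx hu hv x hx'
        rcases List.mem_cons.mp hx' with rfl | hx'
        · exact ⟨hu, hv⟩
        · exact hx x hx'
    rcases lt_trichotomy m j with hmj | rfl | hmj
    · rcases Nat.lt_or_ge (m + 1) j with hmj' | hmj'
      · have hc : f m * wordProd f (jonesWord ((i, j) :: L)) =
            wordProd f (List.range' j (i + 1 - j)) * (f m * wordProd f (jonesWord L)) := by
          rw [jonesWord, wordProd_append, ← mul_assoc, h.comm_wordProd, mul_assoc]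
          intro a ha
          rw [List.mem_range'_1] at ha
          omega
        rcases ih hL' hN with ⟨c, w, hw, hwN', e⟩ | ⟨L', h1, h2, h3, h4⟩
        · refine Or.inl ⟨c, List.range' j (i + 1 - j) ++ w, ?_, ?_, ?_⟩
          · simp [jonesWord]; omega
          · intro a ha
            rcases List.mem_append.mp ha with ha | ha
            · rw [List.mem_range'_1] at ha
              omega
            · exact hwN' a ha
          · rw [hc, e, wordProd_append, mul_smul_comm]
        -- The bounds `h4` carried through the induction keep the entries of `L'` below `i` and `j`,
        -- so the run can be put back in front.
        · refine Or.inr ⟨(i, j) :: L', ⟨hji, h4 i j hlt (by omega) hmj, h1⟩, ?_, ?_, ?_⟩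
          · simp [jonesWord, h2]; omega
          · rw [hc, jonesWord, wordProd_append, h3]
          · intro u v hx hu hv
            simp only [List.mem_cons, forall_eq_or_imp] at hx ⊢
            exact ⟨hx.1, h4 u v hx.2 hu hv⟩
      · obtain rfl : j = m + 1 := by omega
        -- The letter `m` extends the run downwards, unless the next run already starts at `m`.
        by_cases hc : ∀ y ∈ L, y.2 < m
        · refine Or.inr ⟨(i, m) :: L, ⟨by simp; omega, fun y hy => ⟨(hlt y hy).1, hc y hy⟩, hL'⟩,
            ?_, ?_, ?_⟩
          · simp only [jonesWord, List.length_append, List.length_range']; omega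
          · simp only [jonesWord]
            rw [range'_eq_cons (show m ≤ i by omega)]
            simp
          · intro u v hx hu hv
            simp only [List.mem_cons, forall_eq_or_imp] at hx ⊢
            exact ⟨⟨hx.1.1, hv⟩, hx.2⟩
        · push Not at hc
          obtain ⟨y, hy, hmy⟩ := hc
          cases L with
          | nil => simp at hy
          | cons z L =>
          obtain ⟨i', j'⟩ := z
          have hz := hlt _ List.mem_cons_self
          have hz2 := hL'.1
          have hj' : j' = m := by
            rcases List.mem_cons.mp hy with rfl | hy
            · simp only at *; omega
            · have := hL'.2.1 y hy
              simp only at *; omega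
          subst hj'
          simp only at hz hz2
          -- The first letter of the second run commutes back past `j' + 2, …, i`, producing
          -- $f_{j'}f_{j'+1}f_{j'}=f_{j'}$ and saving two letters.
          refine Or.inl ⟨1, j' :: (List.range' (j' + 2) (i + 1 - (j' + 2)) ++
            (List.range' (j' + 1) (i' + 1 - (j' + 1)) ++ jonesWord L)), ?_, ?_, ?_⟩
          · simp only [jonesWord, List.length_append, List.length_range', List.length_cons]; omega
          · intro a ha
            simp only [List.mem_cons, List.mem_append, List.mem_range'_1] at ha
            rcases ha with ha | ha | ha | ha
            · omega
            · omega
            · omega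
            · exact hwN a (by simp [jonesWord, ha])
          · simp only [jonesWord]
            rw [range'_eq_cons (show j' + 1 ≤ i by omega), range'_eq_cons hz2, one_smul]
            simp only [wordProd_append, wordProd_cons]
            have hcm : f j' * wordProd f (List.range' (j' + 2) (i + 1 - (j' + 2))) =
                wordProd f (List.range' (j' + 2) (i + 1 - (j' + 2))) * f j' := by
              apply h.comm_wordProd
              intro a ha
              rw [List.mem_range'_1] at ha
              omega
            have hu := h.up j' (by omega)
            calc _ = f j' * f (j' + 1) * (wordProd f (List.range' (j' + 2) (i + 1 - (j' + 2))) * f j')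
                  * (wordProd f (List.range' (j' + 1) (i' + 1 - (j' + 1))) *
                    wordProd f (jonesWord L)) := by simp only [mul_assoc]
              _ = _ := by
                rw [← hcm, ← mul_assoc (f j' * f (j' + 1)), hu]
                simp only [mul_assoc]
    · refine Or.inl ⟨ξ, jonesWord ((i, m) :: L), by omega, ?_, ?_⟩
      · intro a ha
        obtain ⟨x, hx, h1, h2⟩ := mem_jonesWord.mp ha
        rcases List.mem_cons.mp hx with rfl | hx
        · simp only at *; omega
        · have := hN x hx
          omega
      · simp only [jonesWord]
        rw [range'_eq_cons hji]
        simp only [wordProd_append, wordProd_cons, ← mul_assoc, h.sq, smul_mul_assoc]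
    -- The letter, now called `m + 1`, lies inside the run beyond its start. It commutes past `j, …,
    -- m - 1` and is absorbed by $f_{m+1}f_mf_{m+1}=f_{m+1}$.
    · obtain ⟨m, rfl⟩ : ∃ m', m = m' + 1 := ⟨m - 1, by omega⟩
      refine Or.inl ⟨1, List.range' j (m - j) ++ (List.range' (m + 1) (i + 1 - (m + 1)) ++
        jonesWord L), ?_, ?_, ?_⟩
      · simp only [jonesWord, List.length_append, List.length_range']; omega
      · intro a ha
        simp only [List.mem_append, List.mem_range'_1] at ha
        rcases ha with ha | ha | ha
        · omega
        · omega
        · exact hwN a ha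
      · have hs : List.range' j (i + 1 - j) = List.range' j (m - j) ++ (m :: (m + 1) ::
            List.range' (m + 2) (i + 1 - (m + 2))) := by
          have e1 := range'_eq_cons (show m ≤ i by omega)
          rw [range'_eq_cons him] at e1
          rw [← e1, show m = j + (m - j) by omega]
          rw [show j + (m - j) - j = m - j by omega, List.range'_append_1]
          congr 1
          omega
        have hcm : f (m + 1) * wordProd f (List.range' j (m - j)) =
            wordProd f (List.range' j (m - j)) * f (m + 1) := by
          apply h.comm_wordProd'
          intro a ha
          rw [List.mem_range'_1] at ha
          omega
        have hd := h.down m (by omega)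
        simp only [jonesWord]
        rw [hs, range'_eq_cons him, one_smul]
        simp only [wordProd_append, wordProd_cons]
        rw [← mul_assoc, ← mul_assoc, hcm]
        calc _ = wordProd f (List.range' j (m - j)) * (f (m + 1) * f m * f (m + 1)) *
              (wordProd f (List.range' (m + 2) (i + 1 - (m + 2))) * wordProd f (jonesWord L)) := by
                simp only [mul_assoc]
          _ = _ := by rw [hd]; simp only [mul_assoc]

/-- Letters are multiplied in from the left. Whenever the result is not a normal form of full
length, the length drops strictly, which is what the strong induction on length needs. -/
theorem TLSat.isShort_or_jones (h : TLSat ξ N f) (w : List ℕ) (hw : ∀ a ∈ w, a < N) :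
    IsShort 𝕜 f N w.length (wordProd f w) ∨
    ∃ L, IsJones L ∧ (∀ x ∈ L, x.1 < N) ∧ wordProd f (jonesWord L) = wordProd f w ∧
      (jonesWord L).length = w.length := by
  induction w with
  | nil => exact Or.inr ⟨[], by simp [IsJones, jonesWord]⟩
  | cons m w ih =>
    simp only [List.mem_cons, forall_eq_or_imp] at hw
    rcases ih hw.2 with ⟨c, w', h1, h2, h3⟩ | ⟨L, h1, h2, h3, h4⟩
    · refine Or.inl ⟨c, m :: w', by simpa using h1, ?_, by simp [h3]⟩
      simpa using ⟨hw.1, h2⟩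
    · rcases h.mul_jones hw.1 L h1 h2 with h5 | ⟨L', h5, h6, h7, h8⟩
      · refine Or.inl ?_
        simpa [h4, h3] using h5
      · refine Or.inr ⟨L', h5, fun x hx => ?_, by simp [h7, h3], by simp [h6, h4]⟩
        exact (h8 N N (fun y hy => ⟨h2 y hy, (h1.snd_le_fst y hy).trans_lt (h2 y hy)⟩) hw.1 hw.1 x hx).1

/-- Every word is a multiple of a word in Jones normal form. -/
theorem TLSat.wordProd_mem_span (h : TLSat ξ N f) (w : List ℕ) (hw : ∀ a ∈ w, a < N) :
    wordProd f w ∈ Submodule.span 𝕜 (Set.range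
      fun L : {L : List (ℕ × ℕ) // IsJones L ∧ ∀ x ∈ L, x.1 < N} =>
        wordProd f (jonesWord L.1)) := by
  induction hl : w.length using Nat.strong_induction_on generalizing w with
  | _ l ih =>
    rcases h.isShort_or_jones w hw with ⟨c, w', h1, h2, h3⟩ | ⟨L, h1, h2, h3, _⟩
    · rw [h3]
      exact Submodule.smul_mem _ _ (ih _ (hl ▸ h1) w' h2 rfl)
    · rw [← h3]
      exact Submodule.subset_span ⟨⟨L, h1, h2⟩, rfl⟩

end NormalForm


/-! ### Hopping particles -/

section Hops

/-- The letters of the word move particles in `S` successively one step up, with result `S'`. -/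
def Hops : List ℕ → Finset ℕ → Finset ℕ → Prop
  | [], S, S' => S = S'
  | m :: w, S, S' => m ∈ S ∧ m + 1 ∉ S ∧ Hops w (insert (m + 1) (S.erase m)) S'

theorem Hops.eq {w : List ℕ} {S S₁ S₂ : Finset ℕ} (h₁ : Hops w S S₁) (h₂ : Hops w S S₂) :
    S₁ = S₂ := by
  induction w generalizing S with
  | nil => exact h₁.symm.trans h₂
  | cons m w ih => exact ih h₁.2.2 h₂.2.2

theorem sum_hop {m : ℕ} {S : Finset ℕ} (h : m ∈ S) (h' : m + 1 ∉ S) :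
    ∑ a ∈ insert (m + 1) (S.erase m), a = ∑ a ∈ S, a + 1 := by
  rw [Finset.sum_insert (by simp [h']), ← Finset.add_sum_erase S _ h]
  omega

theorem Hops.sum_eq {w : List ℕ} {S S' : Finset ℕ} (h : Hops w S S') :
    ∑ a ∈ S', a = ∑ a ∈ S, a + w.length := by
  induction w generalizing S with
  | nil => simp [show S = S' from h]
  | cons m w ih =>
    rw [ih h.2.2, sum_hop h.1 h.2.1, List.length_cons]
    omega

/-- The positions `j` of the pairs `(i, j)`. -/
def starts (L : List (ℕ × ℕ)) : Finset ℕ := (L.map fun x => x.2).toFinset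

/-- The positions `i + 1` of the pairs `(i, j)`. -/
def ends (L : List (ℕ × ℕ)) : Finset ℕ := (L.map fun x => x.1 + 1).toFinset

theorem mem_starts {L : List (ℕ × ℕ)} {a : ℕ} : a ∈ starts L ↔ ∃ x ∈ L, x.2 = a := by
  simp [starts]

theorem mem_ends {L : List (ℕ × ℕ)} {a : ℕ} : a ∈ ends L ↔ ∃ x ∈ L, x.1 + 1 = a := by
  simp [ends]

theorem starts_cons (x : ℕ × ℕ) (L : List (ℕ × ℕ)) : starts (x :: L) = insert x.2 (starts L) := by
  simp [starts]

theorem ends_cons (x : ℕ × ℕ) (L : List (ℕ × ℕ)) :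
    ends (x :: L) = insert (x.1 + 1) (ends L) := by
  simp [ends]

theorem IsJones.pairwise {L : List (ℕ × ℕ)} (h : IsJones L) :
    L.Pairwise fun x y => y.1 < x.1 ∧ y.2 < x.2 := by
  induction L with
  | nil => exact .nil
  | cons x L ih => exact .cons h.2.1 (ih h.2.2)

theorem IsJones.card_starts {L : List (ℕ × ℕ)} (h : IsJones L) : (starts L).card = L.length := by
  induction L with
  | nil => simp [starts]
  | cons x L ih =>
    rw [starts_cons, Finset.card_insert_of_notMem, ih h.2.2, List.length_cons]
    rw [mem_starts]
    rintro ⟨y, hy, e⟩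
    exact (h.2.1 y hy).2.ne e

/-- Both coordinates decrease strictly along the list, so each coordinate list is the sorted
enumeration of its set. -/
theorem IsJones.eq_of_starts_of_ends {L L' : List (ℕ × ℕ)} (h : IsJones L) (h' : IsJones L')
    (hs : starts L = starts L') (he : ends L = ends L') : L = L' := by
  have e1 : L.map (fun x => x.2) = L'.map fun x => x.2 := by
    have p : ∀ {L}, IsJones L → (L.map fun x => x.2).Pairwise (· > ·) := fun h =>
      List.pairwise_map.mpr (h.pairwise.imp fun h => h.2)
    refine List.Perm.eq_of_pairwise (le := (· > ·)) (fun a b _ _ h1 h2 => absurd h1 h2.asymm)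
      (p h) (p h') ?_
    exact List.perm_of_nodup_nodup_toFinset_eq ((p h).imp fun h => ne_of_gt h)
      ((p h').imp fun h => ne_of_gt h) hs
  have e2 : L.map (fun x => x.1 + 1) = L'.map fun x => x.1 + 1 := by
    have p : ∀ {L}, IsJones L → (L.map fun x => x.1 + 1).Pairwise (· > ·) := fun h =>
      List.pairwise_map.mpr (h.pairwise.imp fun h => Nat.succ_lt_succ h.1)
    refine List.Perm.eq_of_pairwise (le := (· > ·)) (fun a b _ _ h1 h2 => absurd h1 h2.asymm)
      (p h) (p h') ?_
    exact List.perm_of_nodup_nodup_toFinset_eq ((p h).imp fun h => ne_of_gt h)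
      ((p h').imp fun h => ne_of_gt h) he
  clear hs he h h'
  induction L generalizing L' with
  | nil => cases L' <;> simp_all
  | cons x L ih =>
    cases L' with
    | nil => simp at e1
    | cons x' L' =>
      simp only [List.map_cons, List.cons.injEq, Nat.add_right_cancel_iff] at e1 e2
      rw [ih e1.2 e2.2, Prod.ext e2.1 e1.1]

theorem hops_run {j l : ℕ} {w : List ℕ} {S S' : Finset ℕ} (hj : j ∈ S)
    (hS : ∀ a ∈ S, a ≤ j ∨ j + l < a)
    (h : Hops w (insert (j + l) (S.erase j)) S') : Hops (List.range' j l ++ w) S S' := by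
  induction l generalizing j S with
  | zero => simpa [Finset.insert_erase hj] using h
  | succ l ih =>
    rw [List.range'_succ, List.cons_append]
    have hn : j + 1 ∉ S := fun hn => by have := hS _ hn; omega
    refine ⟨hj, hn, ih (by simp) ?_ ?_⟩
    · intro a ha
      simp only [Finset.mem_insert, Finset.mem_erase] at ha
      rcases ha with rfl | ha
      · omega
      · have := hS a ha.2
        omega
    · rw [Finset.erase_insert (by simp [hn]), add_assoc, add_comm 1 l]
      exact h

theorem Hops.of_run {j l : ℕ} {w : List ℕ} {S S' : Finset ℕ} (hl : 0 < l)
    (h : Hops (List.range' j l ++ w) S S') :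
    j ∈ S ∧ Hops w (insert (j + l) (S.erase j)) S' := by
  induction l generalizing j S with
  | zero => omega
  | succ l ih =>
    rw [List.range'_succ, List.cons_append] at h
    obtain ⟨h1, h2, h3⟩ := h
    refine ⟨h1, ?_⟩
    rcases Nat.eq_zero_or_pos l with rfl | hl
    · simpa using h3
    · have := (ih hl h3).2
      rwa [Finset.erase_insert (by simp [h2]), add_assoc, add_comm 1 l] at this

theorem IsJones.hops {L : List (ℕ × ℕ)} (h : IsJones L) :
    Hops (jonesWord L) (starts L) (ends L) := by
  -- `X` collects the particles that have already moved. They sit above every end still to be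
  -- reached, so they block no later run.
  suffices ∀ X : Finset ℕ, (∀ a ∈ X, ∀ x ∈ L, x.1 + 1 < a) →
      Hops (jonesWord L) (starts L ∪ X) (ends L ∪ X) by
    simpa using this ∅ (by simp)
  induction L with
  | nil => intro X _; simp [jonesWord, Hops, starts, ends]
  | cons x L ih =>
    obtain ⟨i, j⟩ := x
    intro X hX
    obtain ⟨h1, h2, h3⟩ := h
    simp only [List.mem_cons, forall_eq_or_imp] at h1 h2 hX
    have hj : j ∉ starts L ∪ X := by
      simp only [Finset.mem_union, mem_starts, not_or]
      constructor
      · rintro ⟨y, hy, e⟩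
        exact (h2 y hy).2.ne e
      · intro hx
        have := hX j hx
        omega
    refine hops_run (by simp [starts_cons]) ?_ ?_
    · intro a ha
      simp only [starts_cons, Finset.mem_union, Finset.mem_insert, mem_starts] at ha
      rcases ha with (rfl | ⟨y, hy, rfl⟩) | ha
      · omega
      · have := h2 y hy
        omega
      · have := hX a ha
        omega
    · simp only
      have := ih h3 (insert (i + 1) X) (by
        intro a ha y hy
        have hy' := h2 y hy
        rcases Finset.mem_insert.mp ha with rfl | ha
        · omega
        · have := hX a ha
          omega)
      rw [show j + (i + 1 - j) = i + 1 by omega, starts_cons, Finset.insert_union,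
        Finset.erase_insert hj, ends_cons, Finset.insert_union, ← Finset.union_insert,
        ← Finset.union_insert]
      exact this

/-- This gives triangularity: each run must find a particle at its start, and a particle moved
earlier cannot serve, since it now lies above all later starts. -/
theorem IsJones.starts_subset {L : List (ℕ × ℕ)} (h : IsJones L) {S S' : Finset ℕ}
    (hS : Hops (jonesWord L) S S') : starts L ⊆ S := by
  suffices ∀ X : Finset ℕ, Hops (jonesWord L) (S ∪ X) S' → (∀ a ∈ X, ∀ x ∈ L, x.2 < a) →
      starts L ⊆ S from this ∅ (by simpa using hS) (by simp)
  clear hS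
  intro X hS hX
  induction L generalizing S X with
  | nil => simp [starts]
  | cons x L ih =>
    obtain ⟨i, j⟩ := x
    obtain ⟨h1, h2, h3⟩ := h
    simp only [List.mem_cons, forall_eq_or_imp] at h1 h2 hX
    obtain ⟨h4, h5⟩ := Hops.of_run (by simp only; omega) hS
    simp only at h4 h5
    have hjX : j ∉ X := fun hj => (hX j hj).1.ne rfl
    have hjS : j ∈ S := by simpa [hjX] using h4
    rw [starts_cons, Finset.insert_subset_iff]
    refine ⟨hjS, ?_⟩
    rw [Finset.erase_union_distrib, ← Finset.union_insert] at h5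
    refine (ih h3 _ h5 ?_).trans (Finset.erase_subset _ _)
    intro a ha y hy
    have hy' := h2 y hy
    rcases Finset.mem_insert.mp ha with rfl | ha
    · omega
    · exact (hX a (Finset.mem_of_mem_erase ha)).2 y hy

end Hops


/-! ### The Temperley-Lieb action in coordinates -/

section TwoSite

variable {𝕜 : Type*} [Field 𝕜] {k : ℕ}

/-- The operator on functions of `k` spins which acts on the unequal spins `i` and `j`, with
diagonal weights `A` and exchange weights `B`. -/
def twoSite (A B : Fin 2 → 𝕜) (i j : Fin k) : Module.End 𝕜 ((Fin k → Fin 2) → 𝕜) where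
  toFun v y := if y i = y j then 0 else A (y i) * v y + B (y i) * v (y ∘ Equiv.swap i j)
  map_add' v w := by
    funext y
    simp only [Pi.add_apply]
    split <;> ring
  map_smul' c v := by
    funext y
    simp only [Pi.smul_apply, smul_eq_mul, RingHom.id_apply]
    split <;> ring

theorem twoSite_apply (A B : Fin 2 → 𝕜) (i j : Fin k) (v : (Fin k → Fin 2) → 𝕜)
    (y : Fin k → Fin 2) : twoSite A B i j v y =
      if y i = y j then 0 else A (y i) * v y + B (y i) * v (y ∘ Equiv.swap i j) := rfl

/-- On unequal spins the $2\times2$ matrix has determinant $A_0A_1-B_0B_1=0$ and trace $A_0+A_1$, so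
this is Cayley–Hamilton. -/
theorem twoSite_sq {A B : Fin 2 → 𝕜} (hA : A 0 * A 1 = 1) (hB : B 0 * B 1 = 1) (i j : Fin k) :
    twoSite A B i j * twoSite A B i j = (A 0 + A 1) • twoSite A B i j := by
  refine LinearMap.ext fun v => funext fun y => ?_
  have hs : (y ∘ Equiv.swap i j) ∘ Equiv.swap i j = y := by
    funext l; simp
  simp only [Module.End.mul_apply, LinearMap.smul_apply, Pi.smul_apply, smul_eq_mul,
    twoSite_apply, Function.comp_apply, Equiv.swap_apply_left, Equiv.swap_apply_right, hs]
  rcases Fin.exists_fin_two.mp ⟨y i, rfl⟩ with h | h <;>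
  rcases Fin.exists_fin_two.mp ⟨y j, rfl⟩ with h' | h' <;>
  simp [h, h']
  · linear_combination v y * (hB - hA)
  · linear_combination v y * (hB - hA)

theorem twoSite_comm (A B : Fin 2 → 𝕜) {i j i' j' : Fin k} (h1 : i ≠ i') (h2 : i ≠ j')
    (h3 : j ≠ i') (h4 : j ≠ j') :
    twoSite A B i j * twoSite A B i' j' = twoSite A B i' j' * twoSite A B i j := by
  refine LinearMap.ext fun v => funext fun y => ?_
  have hs : (y ∘ Equiv.swap i j) ∘ Equiv.swap i' j' = (y ∘ Equiv.swap i' j') ∘ Equiv.swap i j := by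
    funext l
    simp only [Function.comp_apply]
    congr 1
    simp only [Equiv.swap_apply_def]
    split_ifs <;> simp_all
  simp only [Module.End.mul_apply, twoSite_apply, Function.comp_apply, hs,
    Equiv.swap_apply_of_ne_of_ne h1 h2, Equiv.swap_apply_of_ne_of_ne h3 h4,
    Equiv.swap_apply_of_ne_of_ne h1.symm h3.symm, Equiv.swap_apply_of_ne_of_ne h2.symm h4.symm]
  split_ifs <;> ring

/-- Having rank one, the two-site operator is a cup times a cap. The product of three contains two
zigzags, which straighten to the diagonal matrices with entries $B_1,B_0$ and $B_0,B_1$; their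
product is $B_0B_1=1$. -/
theorem twoSite_up {A B : Fin 2 → 𝕜} (hA : A 0 * A 1 = 1) (hB : B 0 * B 1 = 1) {i j l : Fin k}
    (h1 : i ≠ j) (h2 : j ≠ l) (h3 : i ≠ l) :
    twoSite A B i j * twoSite A B j l * twoSite A B i j = twoSite A B i j := by
  refine LinearMap.ext fun v => funext fun y => ?_
  have hs : ∀ y : Fin k → Fin 2, ∀ i j, (y ∘ Equiv.swap i j) ∘ Equiv.swap i j = y := by
    intro y i j; funext l; simp
  simp only [Module.End.mul_apply, twoSite_apply, Function.comp_apply, hs,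
    Equiv.swap_apply_left, Equiv.swap_apply_right, Equiv.swap_apply_of_ne_of_ne h1 h3,
    Equiv.swap_apply_of_ne_of_ne h3.symm h2.symm]
  rcases Fin.exists_fin_two.mp ⟨y i, rfl⟩ with h | h <;>
  rcases Fin.exists_fin_two.mp ⟨y j, rfl⟩ with h' | h' <;>
  rcases Fin.exists_fin_two.mp ⟨y l, rfl⟩ with h'' | h'' <;>
  simp [h, h', h'']
  · linear_combination (A 0 * v y + B 0 * v (y ∘ Equiv.swap i j)) * hA
  · linear_combination B 0 * v (y ∘ Equiv.swap i j) * hA + A 0 * v y * hB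
  · linear_combination B 1 * v (y ∘ Equiv.swap i j) * hA + A 1 * v y * hB
  · linear_combination (A 1 * v y + B 1 * v (y ∘ Equiv.swap i j)) * hA

theorem twoSite_down {A B : Fin 2 → 𝕜} (hA : A 0 * A 1 = 1) (hB : B 0 * B 1 = 1) {i j l : Fin k}
    (h1 : i ≠ j) (h2 : j ≠ l) (h3 : i ≠ l) :
    twoSite A B j l * twoSite A B i j * twoSite A B j l = twoSite A B j l := by
  refine LinearMap.ext fun v => funext fun y => ?_
  have hs : ∀ y : Fin k → Fin 2, ∀ i j, (y ∘ Equiv.swap i j) ∘ Equiv.swap i j = y := by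
    intro y i j; funext l; simp
  simp only [Module.End.mul_apply, twoSite_apply, Function.comp_apply, hs,
    Equiv.swap_apply_left, Equiv.swap_apply_right, Equiv.swap_apply_of_ne_of_ne h1 h3,
    Equiv.swap_apply_of_ne_of_ne h3.symm h2.symm]
  rcases Fin.exists_fin_two.mp ⟨y i, rfl⟩ with h | h <;>
  rcases Fin.exists_fin_two.mp ⟨y j, rfl⟩ with h' | h' <;>
  rcases Fin.exists_fin_two.mp ⟨y l, rfl⟩ with h'' | h'' <;>
  simp [h, h', h'']
  · linear_combination B 0 * v (y ∘ Equiv.swap j l) * hA + A 0 * v y * hB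
  · linear_combination (A 1 * v y + B 1 * v (y ∘ Equiv.swap j l)) * hA
  · linear_combination (A 0 * v y + B 0 * v (y ∘ Equiv.swap j l)) * hA
  · linear_combination B 1 * v (y ∘ Equiv.swap j l) * hA + A 1 * v y * hB

/-- The operators `twoSite` at adjacent positions. -/
def adjSite (k : ℕ) (A B : Fin 2 → 𝕜) (m : ℕ) : Module.End 𝕜 ((Fin k → Fin 2) → 𝕜) :=
  if h : m + 1 < k then twoSite A B ⟨m, by omega⟩ ⟨m + 1, h⟩ else 0

theorem tlSat_adjSite {A B : Fin 2 → 𝕜} (hA : A 0 * A 1 = 1) (hB : B 0 * B 1 = 1) :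
    TLSat (A 0 + A 1) (k - 1) (adjSite k A B) where
  comm a b h := by
    unfold adjSite
    split_ifs
    · apply twoSite_comm <;> simp only [ne_eq, Fin.mk.injEq] <;> omega
    all_goals simp
  sq a := by
    unfold adjSite
    split_ifs
    · exact twoSite_sq hA hB _ _
    · simp
  up a h := by
    unfold adjSite
    rw [dif_pos (by omega), dif_pos (by omega)]
    apply twoSite_up hA hB <;> simp only [ne_eq, Fin.mk.injEq] <;> omega
  down a h := by
    unfold adjSite
    rw [dif_pos (by omega), dif_pos (by omega)]
    apply twoSite_down hA hB <;> simp only [ne_eq, Fin.mk.injEq] <;> omega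

/-! ### Matrix entries of words between spin configurations -/

/-- The spin configuration with value `1` exactly on `S`. -/
def spins (k : ℕ) (S : Finset ℕ) : Fin k → Fin 2 := fun i => if (i : ℕ) ∈ S then 1 else 0

theorem spins_comp_swap {S : Finset ℕ} {m : ℕ} (hm : m + 1 < k) (h : m ∈ S) (h' : m + 1 ∉ S) :
    spins k S ∘ Equiv.swap ⟨m, by omega⟩ ⟨m + 1, hm⟩ = spins k (insert (m + 1) (S.erase m)) := by
  funext l
  simp only [spins, Function.comp_apply, Finset.mem_insert, Finset.mem_erase]
  congr 1
  rw [Equiv.swap_apply_def]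
  split_ifs with h1 h2
  · subst h1; simp [h']
  · subst h2; simp [h]
  · simp only [Fin.ext_iff] at h1 h2
    simp [h1, h2]

theorem spins_comp_swap' {S : Finset ℕ} {m : ℕ} (hm : m + 1 < k) (h : m ∉ S) (h' : m + 1 ∈ S) :
    spins k S ∘ Equiv.swap ⟨m, by omega⟩ ⟨m + 1, hm⟩ = spins k (insert m (S.erase (m + 1))) := by
  funext l
  simp only [spins, Function.comp_apply, Finset.mem_insert, Finset.mem_erase]
  congr 1
  rw [Equiv.swap_apply_def]
  split_ifs with h1 h2
  · subst h1; simp [h']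
  · subst h2; simp [h]
  · simp only [Fin.ext_iff] at h1 h2
    simp [h1, h2]

theorem spins_injOn {S S' : Finset ℕ} (hS : ∀ a ∈ S, a < k) (hS' : ∀ a ∈ S', a < k)
    (h : spins k S = spins k S') : S = S' := by
  ext a
  by_cases ha : a < k
  · have := congrFun h ⟨a, ha⟩
    simp only [spins] at this
    by_cases h1 : a ∈ S <;> by_cases h2 : a ∈ S' <;> simp_all
  · exact ⟨fun h => absurd (hS a h) ha, fun h => absurd (hS' a h) ha⟩

/-- The entry of a word at `(S, S')`. -/
def entry (k : ℕ) (A B : Fin 2 → 𝕜) (w : List ℕ) (S S' : Finset ℕ) : 𝕜 :=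
  wordProd (adjSite k A B) w (Pi.single (spins k S') 1) (spins k S)

variable {A B : Fin 2 → 𝕜}

theorem entry_cons_of_hop {m : ℕ} (hm : m + 1 < k) {S : Finset ℕ} (h : m ∈ S) (h' : m + 1 ∉ S)
    (w : List ℕ) (S' : Finset ℕ) : entry k A B (m :: w) S S' =
      A 1 * entry k A B w S S' + B 1 * entry k A B w (insert (m + 1) (S.erase m)) S' := by
  have h1 : spins k S ⟨m, by omega⟩ = 1 := by simp [spins, h]
  have h2 : spins k S ⟨m + 1, hm⟩ = 0 := by simp [spins, h']
  unfold entry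
  rw [wordProd_cons, Module.End.mul_apply, ← spins_comp_swap hm h h', adjSite, dif_pos hm,
    twoSite_apply, h1, h2, if_neg (by simp)]

/-- A nonzero entry of a word raises the sum of the positions by at most its length, with equality
only if each letter moves a particle up. -/
theorem hops_of_entry_ne_zero {w : List ℕ} (hw : ∀ a ∈ w, a + 1 < k) {S S' : Finset ℕ}
    (hS : ∀ a ∈ S, a < k) (hS' : ∀ a ∈ S', a < k) (h : entry k A B w S S' ≠ 0)
    (hd : ∑ a ∈ S, a + w.length ≤ ∑ a ∈ S', a) : Hops w S S' := by
  induction w generalizing S with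
  | nil =>
    refine spins_injOn hS hS' ?_
    by_contra hne
    exact h (by simp [entry, hne])
  | cons m w ih =>
    simp only [List.mem_cons, forall_eq_or_imp] at hw
    obtain ⟨hm, hw⟩ := hw
    rw [List.length_cons] at hd
    -- If the sum must rise by more than the remaining length, a nonzero entry would by induction
    -- consist of hops, which raise it by exactly that length. This removes the terms where the
    -- particle stays or moves down.
    have h0 : ∀ {T : Finset ℕ}, (∀ a ∈ T, a < k) → ∑ a ∈ T, a + w.length < ∑ a ∈ S', a →
        entry k A B w T S' = 0 := by
      intro T hT hlt
      by_contra hne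
      have := (ih hw hT hne hlt.le).sum_eq
      omega
    by_cases h1 : m ∈ S <;> by_cases h2 : m + 1 ∈ S
    · refine absurd ?_ h
      rw [entry, wordProd_cons, Module.End.mul_apply, adjSite, dif_pos hm, twoSite_apply,
        if_pos (by simp [spins, h1, h2])]
    · rw [entry_cons_of_hop hm h1 h2, h0 hS (by omega), mul_zero, zero_add] at h
      refine ⟨h1, h2, ih hw ?_ (right_ne_zero_of_mul h) ?_⟩
      · intro a ha
        rcases Finset.mem_insert.mp ha with rfl | ha
        · exact hm
        · exact hS a (Finset.mem_of_mem_erase ha)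
      · rw [sum_hop h1 h2]
        omega
    · refine absurd ?_ h
      have hT : ∀ a ∈ insert m (S.erase (m + 1)), a < k := by
        intro a ha
        rcases Finset.mem_insert.mp ha with rfl | ha
        · omega
        · exact hS a (Finset.mem_of_mem_erase ha)
      have hsum : ∑ a ∈ S, a = ∑ a ∈ insert m (S.erase (m + 1)), a + 1 := by
        rw [Finset.sum_insert (by simp [h1]), ← Finset.add_sum_erase S _ h2]
        omega
      have e1 : entry k A B w S S' = 0 := h0 hS (by omega)
      have e2 : entry k A B w (insert m (S.erase (m + 1))) S' = 0 := h0 hT (by omega)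
      unfold entry at e1 e2
      rw [entry, wordProd_cons, Module.End.mul_apply, adjSite, dif_pos hm, twoSite_apply,
        spins_comp_swap' hm h1 h2, e1, e2]
      simp
    · refine absurd ?_ h
      rw [entry, wordProd_cons, Module.End.mul_apply, adjSite, dif_pos hm, twoSite_apply,
        if_pos (by simp [spins, h1, h2])]

theorem entry_of_hops {w : List ℕ} (hw : ∀ a ∈ w, a + 1 < k) {S S' : Finset ℕ}
    (hS : ∀ a ∈ S, a < k) (hS' : ∀ a ∈ S', a < k) (h : Hops w S S') :
    entry k A B w S S' = B 1 ^ w.length := by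
  induction w generalizing S with
  | nil => simp [entry, show S = S' from h]
  | cons m w ih =>
    have hsum := h.sum_eq
    simp only [List.mem_cons, forall_eq_or_imp] at hw
    obtain ⟨hm, hw⟩ := hw
    obtain ⟨h1, h2, h3⟩ := h
    rw [List.length_cons] at hsum
    have h0 : entry k A B w S S' = 0 := by
      by_contra hne
      have := (hops_of_entry_ne_zero hw hS hS' hne (by omega)).sum_eq
      omega
    rw [entry_cons_of_hop hm h1 h2, h0, ih hw _ h3, List.length_cons, pow_succ']
    · ring
    · intro a ha
      rcases Finset.mem_insert.mp ha with rfl | ha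
      · exact hm
      · exact hS a (Finset.mem_of_mem_erase ha)

/-- The Jones normal forms act by linearly independent operators. -/
theorem linearIndependent_jones (hB : B 1 ≠ 0) :
    LinearIndependent 𝕜 fun L : {L : List (ℕ × ℕ) // IsJones L ∧ ∀ x ∈ L, x.1 < k - 1} =>
      wordProd (adjSite k A B) (jonesWord L.1) := by
  rw [linearIndependent_iff]
  intro c hc
  by_contra hne
  have hsupp : c.support.Nonempty := Finsupp.support_nonempty_iff.mpr hne
  -- `L` has the fewest pairs among the longest words with nonzero coefficient. At its entry from
  -- `starts` to `ends`, shorter words vanish. A word of equal length that does not vanish has its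
  -- starts inside those of `L`, hence equal to them by minimality; then the ends agree too.
  obtain ⟨M, hM, hmax⟩ := c.support.exists_max_image (fun L => (jonesWord L.1).length) hsupp
  obtain ⟨L, hL, hmin⟩ :=
    (c.support.filter fun L => (jonesWord L.1).length = (jonesWord M.1).length).exists_min_image
      (fun L => L.1.length) ⟨M, by simp [hM]⟩
  rw [Finset.mem_filter] at hL
  have hbound : ∀ L : {L : List (ℕ × ℕ) // IsJones L ∧ ∀ x ∈ L, x.1 < k - 1},
      (∀ a ∈ jonesWord L.1, a + 1 < k) ∧ (∀ a ∈ starts L.1, a < k) ∧ ∀ a ∈ ends L.1, a < k := by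
    rintro ⟨L, h1, h2⟩
    refine ⟨fun a ha => ?_, fun a ha => ?_, fun a ha => ?_⟩
    · obtain ⟨x, hx, h3, h4⟩ := mem_jonesWord.mp ha
      have := h2 x hx
      omega
    · obtain ⟨x, hx, rfl⟩ := mem_starts.mp ha
      have h3 := h2 x hx
      have h4 := mem_jonesWord.mpr ⟨x, hx, le_rfl, h1.snd_le_fst x hx⟩
      have := h1.snd_le_fst x hx
      omega
    · obtain ⟨x, hx, rfl⟩ := mem_ends.mp ha
      have := h2 x hx
      omega
  have key := congrFun (LinearMap.congr_fun hc (Pi.single (spins k (ends L.1)) 1))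
    (spins k (starts L.1))
  rw [Finsupp.linearCombination_apply, Finsupp.sum, LinearMap.sum_apply, Finset.sum_apply,
    Finset.sum_eq_single L] at key
  · have e := entry_of_hops (A := A) (B := B) (hbound L).1 (hbound L).2.1 (hbound L).2.2 L.2.1.hops
    simp only [LinearMap.smul_apply, Pi.smul_apply, smul_eq_mul, LinearMap.zero_apply,
      Pi.zero_apply] at key
    rw [entry] at e
    rw [e] at key
    exact (mul_ne_zero (Finsupp.mem_support_iff.mp hL.1) (pow_ne_zero _ hB)) key
  · intro L' hL' hne'
    simp only [LinearMap.smul_apply, Pi.smul_apply, smul_eq_mul]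
    refine mul_eq_zero_of_right _ ?_
    by_contra hne0
    have hl := hmax L' hL'
    have hsum := L.2.1.hops.sum_eq
    have hh := hops_of_entry_ne_zero (hbound L').1 (hbound L).2.1 (hbound L).2.2 hne0
      (by have := hL.2; omega)
    have hp := hmin L' (Finset.mem_filter.mpr ⟨hL', by
      have := hh.sum_eq
      have := hL.2
      omega⟩)
    have hs : starts L'.1 = starts L.1 := by
      refine Finset.eq_of_subset_of_card_le (L'.2.1.starts_subset hh) ?_
      rw [L.2.1.card_starts, L'.2.1.card_starts]
      exact hp
    refine hne' (Subtype.ext (L'.2.1.eq_of_starts_of_ends L.2.1 hs ?_))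
    rw [← hs] at hh
    exact L'.2.1.hops.eq hh
  · intro h
    exact absurd hL.1 h

end TwoSite


/-! ### The operators `Ř` in coordinates -/

section Coords

variable {𝕜 : Type*} [Field 𝕜]

/-- The coordinates of a tensor in the basis of tensors of standard basis vectors. -/
noncomputable def coords (𝕜 : Type*) [Field 𝕜] (k : ℕ) :
    TensorPower 𝕜 k (Fin 2 → 𝕜) ≃ₗ[𝕜] ((Fin k → Fin 2) → 𝕜) :=
  (Basis.piTensorProduct fun _ : Fin k => Pi.basisFun 𝕜 (Fin 2)).equivFun

theorem coords_tprod {k : ℕ} (v : Fin k → Fin 2 → 𝕜) (y : Fin k → Fin 2) :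
    coords 𝕜 k (PiTensorProduct.tprod 𝕜 v) y = ∏ i, v i (y i) := by
  simp [coords, Module.Basis.equivFun_apply, Basis.piTensorProduct_repr_tprod_apply]

theorem coords_swapSlots {k : ℕ} (i j : Fin k) (t : TensorPower 𝕜 k (Fin 2 → 𝕜))
    (y : Fin k → Fin 2) : coords 𝕜 k (swapSlots 𝕜 (Fin 2 → 𝕜) k i j t) y =
      coords 𝕜 k t (y ∘ Equiv.swap i j) := by
  induction t using PiTensorProduct.induction_on with
  | smul_tprod c v =>
    simp only [map_smul, Pi.smul_apply, swapSlots, LinearEquiv.coe_coe]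
    rw [PiTensorProduct.reindex_tprod, coords_tprod, coords_tprod]
    congr 1
    refine Fintype.prod_equiv (Equiv.swap i j) _ _ fun l => ?_
    simp
  | add s t hs ht => simp only [map_add, Pi.add_apply, hs, ht]

theorem coords_slot {k : ℕ} (i : Fin k) (f : Module.End 𝕜 (Fin 2 → 𝕜))
    (t : TensorPower 𝕜 k (Fin 2 → 𝕜)) (y : Fin k → Fin 2) :
    coords 𝕜 k (slot k i f t) y =
      ∑ z, LinearMap.toMatrix' f (y i) z * coords 𝕜 k t (Function.update y i z) := by
  induction t using PiTensorProduct.induction_on with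
  | smul_tprod c v =>
    simp only [map_smul, Pi.smul_apply, slot, MultilinearMap.toLinearMap_apply,
      PiTensorProduct.mapMultilinear_apply, PiTensorProduct.map_tprod, coords_tprod, smul_eq_mul]
    have e1 : ∏ l, (Function.update (fun _ : Fin k => (LinearMap.id : Module.End 𝕜 (Fin 2 → 𝕜))) i f)
        l (v l) (y l) = f (v i) (y i) * ∏ l ∈ Finset.univ.erase i, v l (y l) := by
      rw [← Finset.mul_prod_erase _ _ (Finset.mem_univ i), Function.update_self]
      congr 1
      refine Finset.prod_congr rfl fun l hl => ?_
      rw [Function.update_of_ne (Finset.ne_of_mem_erase hl), LinearMap.id_apply]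
    have e2 : ∀ z, ∏ l, v l (Function.update y i z l) =
        v i z * ∏ l ∈ Finset.univ.erase i, v l (y l) := by
      intro z
      rw [← Finset.mul_prod_erase _ _ (Finset.mem_univ i), Function.update_self]
      congr 1
      refine Finset.prod_congr rfl fun l hl => ?_
      rw [Function.update_of_ne (Finset.ne_of_mem_erase hl)]
    have e3 : f (v i) (y i) = ∑ z, LinearMap.toMatrix' f (y i) z * v i z := by
      conv_lhs => rw [← LinearMap.toMatrix'_mulVec f]
      rfl
    rw [e1, e3]
    simp only [e2, Fin.sum_univ_two]
    ring
  | add s t hs ht => simp only [map_add, Pi.add_apply, hs, ht, mul_add, Finset.sum_add_distrib]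

end Coords

/-! ### Fourier inversion at a root of unity -/

section RootOfUnity

variable {𝕜 : Type*} [Field 𝕜] {n : ℕ} {q : 𝕜}

theorem qpow_ne_zero [n.AtLeastTwo] (hq : IsPrimitiveRoot q n) (x : ZMod n) : qpow q x ≠ 0 :=
  pow_ne_zero _ (hq.ne_zero (NeZero.ne n))

theorem qpow_neg [n.AtLeastTwo] (hq : IsPrimitiveRoot q n) (x : ZMod n) :
    qpow q (-x) = (qpow q x)⁻¹ := by
  refine eq_inv_of_mul_eq_one_left ?_
  rw [← qpow_add hq, neg_add_cancel, qpow_zero]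

/-- Fourier inversion on `ZMod n`. -/
theorem sum_sum_qpow [n.AtLeastTwo] [CharZero 𝕜] (hq : IsPrimitiveRoot q n) (x y : ZMod n) :
    (1 / (n : 𝕜)) * ∑ m ∈ Finset.range n, ∑ t ∈ Finset.range n,
      q ^ (-((t : ℤ) * m)) * (qpow q x ^ t * qpow q y ^ m) = qpow q (x * y) := by
  have hn : (n : 𝕜) ≠ 0 := Nat.cast_ne_zero.mpr (NeZero.ne n)
  have q0 : q ≠ 0 := hq.ne_zero (NeZero.ne n)
  -- The sum over `t` is geometric with ratio $q^{x-m}$, an $n$th root of unity, so only $m=x$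
  -- survives.
  have key : ∀ m ∈ Finset.range n, ∑ t ∈ Finset.range n,
      q ^ (-((t : ℤ) * m)) * (qpow q x ^ t * qpow q y ^ m) =
      if m = x.val then n * qpow q (x * y) else 0 := by
    intro m hm
    rw [Finset.mem_range] at hm
    have e : ∀ t : ℕ, q ^ (-((t : ℤ) * m)) * (qpow q x ^ t * qpow q y ^ m) =
        (q ^ x.val * (q ^ m)⁻¹) ^ t * qpow q y ^ m := by
      intro t
      rw [mul_pow, inv_pow, ← pow_mul q m, zpow_neg, mul_comm (t : ℤ), ← Nat.cast_mul, zpow_natCast,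
        qpow]
      ring
    simp only [e, ← Finset.sum_mul]
    split_ifs with h
    · subst h
      rw [mul_inv_cancel₀ (pow_ne_zero _ q0)]
      simp only [one_pow, Finset.sum_const, Finset.card_range, nsmul_eq_mul, mul_one]
      congr 1
      rw [qpow, qpow, ZMod.val_mul, ← pow_mul, ← pow_eq_pow_mod _ hq.pow_eq_one, mul_comm]
    · have h1 : q ^ x.val * (q ^ m)⁻¹ ≠ 1 := by
        intro h1
        rw [mul_inv_eq_one₀ (pow_ne_zero _ q0)] at h1
        exact h (hq.pow_inj hm x.val_lt h1.symm)
      have h2 : (q ^ x.val * (q ^ m)⁻¹) ^ n = 1 := by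
        rw [mul_pow, inv_pow, ← pow_mul, ← pow_mul, mul_comm _ n, mul_comm _ n, pow_mul, pow_mul,
          hq.pow_eq_one]
        simp
      have h3 := mul_neg_geom_sum (q ^ x.val * (q ^ m)⁻¹) n
      rw [h2, sub_self] at h3
      rw [(mul_eq_zero.mp h3).resolve_left (sub_ne_zero.mpr h1.symm), zero_mul]
  rw [Finset.sum_congr rfl key, Finset.sum_ite_eq' , if_pos (by simpa using x.val_lt)]
  field_simp

end RootOfUnity

/-! ### The R-matrix as a two-site operator -/

section CheckR

variable {𝕜 : Type*} [Field 𝕜] {n : ℕ} {q : 𝕜}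

theorem toMatrix'_V2 [n.AtLeastTwo] (hq : IsPrimitiveRoot q n) (r : ZMod n) (x : D hq) :
    LinearMap.toMatrix' (V2 hq r x) = D.lift hq (matGen q r) (sat_matGen hq r) x := by
  exact LinearMap.toMatrix'_toLin' _

/-- The entries of the action of the R-matrix on `V(2, r) ⊗ V(2, r)`. -/
theorem sum_Rmatrix_entries [n.AtLeastTwo] [CharZero 𝕜] (hq : IsPrimitiveRoot q n) (r : ZMod n)
    (α β z z' : Fin 2) :
    (1 / (n : 𝕜)) * ∑ m ∈ Finset.range n, ∑ s ∈ Finset.range n, ∑ t ∈ Finset.range n,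
      (q ^ (-((t : ℤ) * m)) / qFactorial q s) *
        ((matGen q r .a ^ s * matGen q r .b ^ t) α z *
          (matGen q r .c ^ m * matGen q r .d ^ s) β z') =
    (if α = z ∧ β = z' then qpow q ((r + ((α : ℕ) : ZMod n)) * (((β : ℕ) : ZMod n) - (r + 1))) else 0) +
    if α = 1 ∧ z = 0 ∧ β = 0 ∧ z' = 1 then (1 - q⁻¹) * qpow q (-(r * (r + 1))) else 0 := by
  have hdiag : ∀ (x y : 𝕜) (l : ℕ),
      (!![x, 0; 0, y] : Matrix (Fin 2) (Fin 2) 𝕜) ^ l = !![x ^ l, 0; 0, y ^ l] := by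
    intro x y l
    induction l with
    | zero => simp [Matrix.one_fin_two]
    | succ l ih => rw [pow_succ, ih]; simp [pow_succ]
  have hs : ∀ m : ℕ, ∑ s ∈ Finset.range n, ∑ t ∈ Finset.range n,
      (q ^ (-((t : ℤ) * m)) / qFactorial q s) *
        ((matGen q r .a ^ s * matGen q r .b ^ t) α z *
          (matGen q r .c ^ m * matGen q r .d ^ s) β z') =
      ∑ t ∈ Finset.range n, q ^ (-((t : ℤ) * m)) *
        ((matGen q r .b ^ t) α z * (matGen q r .c ^ m) β z') +
      ∑ t ∈ Finset.range n, q ^ (-((t : ℤ) * m)) *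
        ((matGen q r .a * matGen q r .b ^ t) α z * (matGen q r .c ^ m * matGen q r .d) β z') := by
    -- Only $s=0,1$ contribute, since $a^2=0$ on $V(2,r)$; both quantum factorials are 1.
    intro m
    have hn : 2 ≤ n := Nat.AtLeastTwo.prop
    rw [← Finset.sum_subset (Finset.range_mono hn), Finset.sum_range_succ, Finset.sum_range_one]
    · simp [qFactorial]
    · intro s _ hs
      have ha : matGen q r .a ^ s = 0 := pow_eq_zero_of_le (by simpa using hs : 1 < s)
        (by ext i j; fin_cases i <;> fin_cases j <;> simp [matGen, pow_two])
      simp [ha]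
  rw [Finset.sum_congr rfl fun m _ => hs m, Finset.sum_add_distrib, mul_add]
  have hb : ∀ t : ℕ, (matGen q r .b ^ t) α z =
      if α = z then qpow q (r + ((α : ℕ) : ZMod n)) ^ t else 0 := by
    intro t
    rw [matGen, hdiag]
    fin_cases α <;> fin_cases z <;> simp
  have hc : ∀ m : ℕ, (matGen q r .c ^ m) β z' =
      if β = z' then qpow q (((β : ℕ) : ZMod n) - (r + 1)) ^ m else 0 := by
    intro m
    rw [matGen, hdiag]
    fin_cases β <;> fin_cases z' <;> simp
  have hab : ∀ t : ℕ, (matGen q r .a * matGen q r .b ^ t) α z =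
      if α = 1 ∧ z = 0 then qpow q r ^ t else 0 := by
    intro t
    rw [matGen, matGen, hdiag]
    fin_cases α <;> fin_cases z <;> simp
  have hcd : ∀ m : ℕ, (matGen q r .c ^ m * matGen q r .d) β z' =
      if β = 0 ∧ z' = 1 then qpow q (-(r + 1)) ^ m * (1 - q⁻¹) else 0 := by
    intro m
    rw [matGen, matGen, hdiag]
    fin_cases β <;> fin_cases z' <;> simp
  simp only [hb, hc, hab, hcd]
  congr 1
  · rw [← sum_sum_qpow hq]
    split_ifs <;> simp_all
  · rw [← mul_neg, ← sum_sum_qpow hq]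
    split_ifs <;> simp_all only [and_self, not_true_eq_false, and_true, and_false,
      mul_zero, zero_mul, Finset.sum_const_zero, not_false_eq_true]
    simp only [Finset.mul_sum]
    exact Finset.sum_congr rfl fun _ _ => Finset.sum_congr rfl fun _ _ => by ring

/-- On equal spins $\check{\mathsf R}$ is the scalar $\lambda_r$, so the difference vanishes. On
unequal spins the diagonal part of $\mathcal R$ becomes the exchange term after the interchange. The
part $a\otimes d$ becomes a diagonal term, present only for the spins $(0,1)$: there the weight is
$p(1-q^{-1}-1)=-p^{-1}$, against $-p$ for $(1,0)$. -/
theorem coords_checkR [n.AtLeastTwo] [CharZero 𝕜] (hq : IsPrimitiveRoot q n) {p : 𝕜}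
    (hp : p ^ 2 = q) (r : ZMod n) (k : ℕ) (i : Fin (k - 1)) (t : TensorPower 𝕜 k (Fin 2 → 𝕜)) :
    coords 𝕜 k ((p • ((qpow q (-(r * (r + 1))))⁻¹ •
      checkR (V2 hq r) (Rmatrix hq) k i - 1) : Module.End 𝕜 _) t) =
    adjSite k ![-p⁻¹, -p] ![p⁻¹ * qpow q (-r), p * qpow q r] i (coords 𝕜 k t) := by
  funext y
  have hi : (i : ℕ) + 1 < k := by omega
  rw [adjSite, dif_pos hi, twoSite_apply]
  generalize hi₀ : (⟨i, by omega⟩ : Fin k) = i₀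
  generalize hi₁ : (⟨i + 1, hi⟩ : Fin k) = i₁
  have hne : i₀ ≠ i₁ := by
    rw [← hi₀, ← hi₁, ne_eq, Fin.mk.injEq]
    omega
  have hR : ∀ y, coords 𝕜 k (actSlots (V2 hq r) k i₀ i₁ (Rmatrix hq) t) y = ∑ z, ∑ z',
      ((if y i₀ = z ∧ y i₁ = z' then
          qpow q ((r + ((y i₀ : ℕ) : ZMod n)) * (((y i₁ : ℕ) : ZMod n) - (r + 1))) else 0) +
        if y i₀ = 1 ∧ z = 0 ∧ y i₁ = 0 ∧ z' = 1 then (1 - q⁻¹) * qpow q (-(r * (r + 1))) else 0) *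
      coords 𝕜 k t (Function.update (Function.update y i₀ z) i₁ z') := by
    intro y
    simp only [← sum_Rmatrix_entries hq r]
    simp only [actSlots, Rmatrix, map_smul, map_sum, TensorProduct.map_tmul, LinearMap.mul'_apply,
      LinearMap.smul_apply, LinearMap.sum_apply, Pi.smul_apply, Finset.sum_apply, smul_eq_mul,
      Module.End.mul_apply, coords_slot, LinearMap.comp_apply, AlgHom.toLinearMap_apply,
      toMatrix'_V2, Function.update_of_ne hne.symm]
    simp only [map_mul, map_pow, D.lift_gen, Fin.sum_univ_two, Finset.mul_sum, Finset.sum_mul, ← Finset.sum_add_distrib]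
    refine Finset.sum_congr rfl fun _ _ => Finset.sum_congr rfl fun _ _ =>
      Finset.sum_congr rfl fun _ _ => by ring
  have hc : coords 𝕜 k (checkR (V2 hq r) (Rmatrix hq) k i t) y =
      coords 𝕜 k (actSlots (V2 hq r) k i₀ i₁ (Rmatrix hq) t) (y ∘ Equiv.swap i₀ i₁) := by
    rw [checkR, Module.End.mul_apply, coords_swapSlots, hi₀, hi₁]
  have e1 : Function.update (Function.update (y ∘ Equiv.swap i₀ i₁) i₀ (y i₁)) i₁ (y i₀) =
      y ∘ Equiv.swap i₀ i₁ := by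
    funext l
    simp only [Function.update_apply, Function.comp_apply, Equiv.swap_apply_def]
    split_ifs <;> simp_all
  have e2 : Function.update (Function.update (y ∘ Equiv.swap i₀ i₁) i₀ (y i₀)) i₁ (y i₁) = y := by
    funext l
    simp only [Function.update_apply, Function.comp_apply, Equiv.swap_apply_def]
    split_ifs <;> simp_all
  have q0 : q ≠ 0 := hq.ne_zero (NeZero.ne n)
  have p0 : p ≠ 0 := by rintro rfl; exact q0 (by simpa using hp.symm)
  have hl := qpow_ne_zero hq (-(r * (r + 1)))
  -- The factor $\lambda_r$ is extracted from the four diagonal weights of $\mathcal R$: `f1`, `f2`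
  -- for equal spins, `f3`, `f4` for unequal ones.
  have f1 : qpow q (r * (-1 + -r)) = qpow q (-(r * (r + 1))) := by congr 1; ring
  have f2 : qpow q (-((r + 1) * r)) = qpow q (-(r * (r + 1))) := by congr 1; ring
  have f3 : qpow q (-(r * r)) = qpow q (-(r * (r + 1))) * qpow q r := by
    rw [← qpow_add hq]; congr 1; ring
  have f4 : qpow q ((r + 1) * (-1 + -r)) = qpow q (-(r * (r + 1))) * (q⁻¹ * qpow q (-r)) := by
    rw [← qpow_one (n := n) (q := q), ← qpow_neg hq, qpow_one, ← qpow_add hq, ← qpow_add hq]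
    congr 1; ring
  simp only [LinearMap.smul_apply, LinearMap.sub_apply, map_smul, map_sub, Pi.smul_apply,
    Pi.sub_apply, smul_eq_mul, Module.End.one_apply, hc, hR, Function.comp_apply,
    Equiv.swap_apply_left, Equiv.swap_apply_right]
  rcases Fin.exists_fin_two.mp ⟨y i₀, rfl⟩ with h | h <;>
  rcases Fin.exists_fin_two.mp ⟨y i₁, rfl⟩ with h' | h' <;>
  simp only [h, h'] at e1 e2 ⊢ <;>
  simp [e1, e2, f1, f2, f3, f4, hl, p0]
  -- For equal spins the interchange fixes the configuration.
  · rw [e1.symm.trans e2, sub_self]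
  · field_simp
    rw [← hp]
    ring
  · field_simp
    ring
  · rw [e1.symm.trans e2, sub_self]

end CheckR


/-! ### The action of `D_n` in coordinates -/

section Slice

/-- The part of a function of `k + 1` spins where the last spin is `d`. -/
def slice {𝕜 : Type*} {k : ℕ} (d : Fin 2) (v : (Fin (k + 1) → Fin 2) → 𝕜) : (Fin k → Fin 2) → 𝕜 :=
  fun y => v (Fin.snoc (α := fun _ => Fin 2) y d)

theorem slice_ext {𝕜 : Type*} {k : ℕ} {v w : (Fin (k + 1) → Fin 2) → 𝕜} (h : ∀ d, slice d v = slice d w) :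
    v = w := by
  funext y
  have := congrFun (h (y (Fin.last k))) (Fin.init y)
  simpa only [slice, Fin.snoc_init_self] using this

variable {𝕜 : Type*} [Field 𝕜]

theorem slice_add {k : ℕ} (d : Fin 2) (v w : (Fin (k + 1) → Fin 2) → 𝕜) :
    slice d (v + w) = slice d v + slice d w := rfl

theorem slice_smul {k : ℕ} (d : Fin 2) (c : 𝕜) (v : (Fin (k + 1) → Fin 2) → 𝕜) :
    slice d (c • v) = c • slice d v := rfl

theorem snoc_comp_swap_castSucc {k : ℕ} (y : Fin k → Fin 2) (d : Fin 2) (i j : Fin k) :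
    (Fin.snoc (α := fun _ => Fin 2) y d) ∘ Equiv.swap i.castSucc j.castSucc =
      Fin.snoc (α := fun _ => Fin 2) (y ∘ Equiv.swap i j) d := by
  funext l
  refine Fin.lastCases ?_ (fun l => ?_) l
  · rw [Function.comp_apply, Equiv.swap_apply_of_ne_of_ne (Fin.castSucc_lt_last i).ne'
      (Fin.castSucc_lt_last j).ne', Fin.snoc_last, Fin.snoc_last]
  · rw [Function.comp_apply, ← (Fin.castSucc_injective k).map_swap, Fin.snoc_castSucc,
      Fin.snoc_castSucc, Function.comp_apply]

theorem slice_adjSite {k m : ℕ} (hm : m + 1 < k) (A B : Fin 2 → 𝕜) (d : Fin 2)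
    (v : (Fin (k + 1) → Fin 2) → 𝕜) :
    slice d (adjSite (k + 1) A B m v) = adjSite k A B m (slice d v) := by
  funext y
  rw [adjSite, adjSite, dif_pos hm, dif_pos (by omega), slice, twoSite_apply, twoSite_apply]
  have e0 : (⟨m, by omega⟩ : Fin (k + 1)) = Fin.castSucc ⟨m, by omega⟩ := rfl
  have e1 : (⟨m + 1, by omega⟩ : Fin (k + 1)) = Fin.castSucc ⟨m + 1, hm⟩ := rfl
  rw [e0, e1, Fin.snoc_castSucc, Fin.snoc_castSucc, snoc_comp_swap_castSucc]
  rfl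

theorem slice_slice_adjSite {k : ℕ} (A B : Fin 2 → 𝕜) (c d : Fin 2)
    (v : (Fin (k + 2) → Fin 2) → 𝕜) :
    slice c (slice d (adjSite (k + 2) A B k v)) =
      if c = d then 0 else A c • slice c (slice d v) + B c • slice d (slice c v) := by
  funext y
  rw [adjSite, dif_pos (by omega), slice, slice, twoSite_apply]
  have e0 : (⟨k, by omega⟩ : Fin (k + 2)) = (Fin.last k).castSucc := rfl
  have e1 : (⟨k + 1, by omega⟩ : Fin (k + 2)) = Fin.last (k + 1) := rfl
  rw [e0, e1, Fin.snoc_castSucc, Fin.snoc_last, Fin.snoc_last]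
  have e : (Fin.snoc (α := fun _ => Fin 2) (Fin.snoc (α := fun _ => Fin 2) y c) d) ∘
      Equiv.swap (Fin.last k).castSucc (Fin.last (k + 1)) =
      Fin.snoc (α := fun _ => Fin 2) (Fin.snoc (α := fun _ => Fin 2) y d) c := by
    funext l
    refine Fin.lastCases ?_ (fun l => ?_) l
    · simp
    · refine Fin.lastCases ?_ (fun l => ?_) l
      · simp
      · rw [Function.comp_apply, Equiv.swap_apply_of_ne_of_ne
          (by simp) (Fin.castSucc_lt_last _).ne]
        simp
  rw [e]
  split_ifs <;> rfl

theorem coords_snocEquiv {k : ℕ} (t : TensorPower 𝕜 k (Fin 2 → 𝕜)) (u : Fin 2 → 𝕜) (d : Fin 2) :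
    slice d (coords 𝕜 (k + 1) (snocEquiv 𝕜 (Fin 2 → 𝕜) k (t ⊗ₜ u))) = u d • coords 𝕜 k t := by
  induction t using PiTensorProduct.induction_on with
  | smul_tprod c w =>
    funext y
    rw [← TensorProduct.smul_tmul', map_smul, map_smul, map_smul, slice_smul, smul_comm]
    simp only [Pi.smul_apply]
    congr 1
    have : snocEquiv 𝕜 (Fin 2 → 𝕜) k (PiTensorProduct.tprod 𝕜 w ⊗ₜ u) =
        PiTensorProduct.tprod 𝕜 (Fin.append w fun _ => u) := by
      rw [← TensorPower.tprod_mul_tprod]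
      simp [snocEquiv, TensorPower.gMul_def, PiTensorProduct.subsingletonEquiv_symm_apply]
      congr 2
      funext i
      simp [Function.update, Subsingleton.elim i 0]
    rw [this, slice, coords_tprod, coords_tprod, Fin.prod_univ_castSucc, mul_comm, smul_eq_mul]
    congr 1
    · rw [Fin.snoc_last]
      exact congrFun (Fin.append_right w (fun _ : Fin 1 => u) 0) d
    · refine Finset.prod_congr rfl fun l _ => ?_
      rw [Fin.snoc_castSucc]
      exact congrFun (Fin.append_left w (fun _ : Fin 1 => u) l) _
  | add s t hs ht =>
    simp only [TensorProduct.add_tmul, map_add, slice_add, hs, ht, smul_add]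

end Slice

/-! ### Skew-primitive elements on tensor powers -/

section Bialgebra

variable {𝕜 H : Type*} [Field 𝕜] [Ring H] [Bialgebra 𝕜 H]

/-- The action on a tensor power, in coordinates. -/
noncomputable def coordRep (ρ : H →ₐ[𝕜] Module.End 𝕜 (Fin 2 → 𝕜)) (k : ℕ) :
    H →ₐ[𝕜] Module.End 𝕜 ((Fin k → Fin 2) → 𝕜) :=
  ((coords 𝕜 k).conjAlgEquiv 𝕜).toAlgHom.comp (powRep ρ k)

theorem coordRep_coords (ρ : H →ₐ[𝕜] Module.End 𝕜 (Fin 2 → 𝕜)) (k : ℕ) (x : H)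
    (t : TensorPower 𝕜 k (Fin 2 → 𝕜)) :
    coordRep ρ k x (coords 𝕜 k t) = coords 𝕜 k (powRep ρ k x t) := by
  simp [coordRep, LinearEquiv.conjAlgEquiv_apply]

/-- A skew-primitive element acts on the last tensor factor through `X`, and on the other ones
with the last factor multiplied by `G`. -/
theorem slice_coordRep {ρ : H →ₐ[𝕜] Module.End 𝕜 (Fin 2 → 𝕜)} {x x' g : H} {G : Fin 2 → 𝕜}
    {X : Fin 2 → Fin 2 → 𝕜} (hx : Bialgebra.comulAlgHom 𝕜 H x = x ⊗ₜ g + 1 ⊗ₜ x')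
    (hG : ∀ u d, ρ g u d = G d * u d) (hX : ∀ u d, ρ x' u d = X d 0 * u 0 + X d 1 * u 1)
    (k : ℕ) (d : Fin 2) (v : (Fin (k + 1) → Fin 2) → 𝕜) :
    slice d (coordRep ρ (k + 1) x v) =
      G d • coordRep ρ k x (slice d v) + (X d 0 • slice 0 v + X d 1 • slice 1 v) := by
  obtain ⟨w, rfl⟩ := (coords 𝕜 (k + 1)).surjective v
  obtain ⟨s, rfl⟩ := (snocEquiv 𝕜 (Fin 2 → 𝕜) k).surjective w
  rw [coordRep_coords]
  have e : powRep ρ (k + 1) x (snocEquiv 𝕜 (Fin 2 → 𝕜) k s) =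
      snocEquiv 𝕜 (Fin 2 → 𝕜) k (tensorRep (powRep ρ k) ρ x s) := by
    simp [powRep, LinearEquiv.conjAlgEquiv_apply]
  rw [e]
  induction s using TensorProduct.induction_on with
  | zero =>
    have : ∀ d : Fin 2, slice d (0 : (Fin (k + 1) → Fin 2) → 𝕜) = 0 := fun _ => rfl
    rw [LinearMap.map_zero, LinearEquiv.map_zero, LinearEquiv.map_zero]
    simp only [this, smul_zero, add_zero]
    rw [LinearMap.map_zero, smul_zero]
  | tmul t u =>
    simp only [tensorRep, AlgHom.comp_apply, hx, map_add, Algebra.TensorProduct.map_tmul, map_one,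
      LinearMap.add_apply, Module.endTensorEndAlgHom_apply, TensorProduct.AlgebraTensorModule.map_tmul,
      slice_add, coords_snocEquiv, map_smul, coordRep_coords, hG, hX, Module.End.one_apply]
    module
  | add s t hs ht =>
    simp only [map_add, slice_add] at hs ht ⊢
    rw [hs (by simp [powRep, LinearEquiv.conjAlgEquiv_apply]),
      ht (by simp [powRep, LinearEquiv.conjAlgEquiv_apply])]
    simp only [smul_add]
    abel

/-- A skew-primitive element which commutes with a two-site operator on two factors commutes with
it on any two adjacent factors. -/
theorem adjSite_comm_coordRep {ρ : H →ₐ[𝕜] Module.End 𝕜 (Fin 2 → 𝕜)} {x x' g : H} {G : Fin 2 → 𝕜}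
    {X : Fin 2 → Fin 2 → 𝕜} (hx : Bialgebra.comulAlgHom 𝕜 H x = x ⊗ₜ g + 1 ⊗ₜ x')
    (hG : ∀ u d, ρ g u d = G d * u d) (hX : ∀ u d, ρ x' u d = X d 0 * u 0 + X d 1 * u 1)
    {A B : Fin 2 → 𝕜}
    (hloc : ∀ (f : Fin 2 → Fin 2 → 𝕜) (t δ : (Fin 2 → Fin 2 → 𝕜) → Fin 2 → Fin 2 → 𝕜),
      (∀ f c d, t f c d = if c = d then 0 else A c * f c d + B c * f d c) →
      (∀ f c d, δ f c d = G d * (X c 0 * f 0 d + X c 1 * f 1 d) +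
        (X d 0 * f c 0 + X d 1 * f c 1)) → ∀ c d, t (δ f) c d = δ (t f) c d)
    (k m : ℕ) (v : (Fin k → Fin 2) → 𝕜) :
    coordRep ρ k x (adjSite k A B m v) = adjSite k A B m (coordRep ρ k x v) := by
  by_cases hm : m + 1 < k
  swap
  · simp [adjSite, hm]
  induction k with
  | zero => omega
  | succ k ih =>
    rcases Nat.lt_or_ge (m + 1) k with hm' | hm'
    · refine slice_ext fun d => ?_
      rw [slice_coordRep hx hG hX, slice_adjSite hm', slice_adjSite hm', slice_adjSite hm',
        slice_adjSite hm', ih _ hm', slice_coordRep hx hG hX]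
      simp only [map_add, map_smul]
    -- The pair is now the last two sites. The term where `x` acts on the earlier factors carries
    -- the weight `G c * G d`, symmetric in the two spins, so it commutes with the exchange; `hloc`
    -- settles the rest.
    · obtain rfl : k = m + 1 := by omega
      refine slice_ext fun d => slice_ext fun c => ?_
      rw [slice_slice_adjSite, slice_coordRep hx hG hX]
      simp only [slice_add, slice_smul, slice_coordRep hx hG hX, slice_slice_adjSite]
      funext y
      have := hloc (fun c d => slice c (slice d v) y)
        (fun f c d => if c = d then 0 else A c * f c d + B c * f d c)
        (fun f c d => G d * (X c 0 * f 0 d + X c 1 * f 1 d) +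
        (X d 0 * f c 0 + X d 1 * f c 1)) (fun _ _ _ => rfl) (fun _ _ _ => rfl) c d
      simp only at this
      by_cases hcd : c = d
      · subst hcd
        simp only [if_true] at this ⊢
        simp only [map_zero, smul_zero, zero_add, Pi.zero_apply, Pi.add_apply, Pi.smul_apply,
          smul_eq_mul, apply_ite (fun f : (Fin m → Fin 2) → 𝕜 => f y)]
        exact this.symm
      · simp only [if_neg hcd] at this ⊢
        simp only [map_add, map_smul, Pi.zero_apply, Pi.add_apply, Pi.smul_apply,
          smul_eq_mul, apply_ite (fun f : (Fin m → Fin 2) → 𝕜 => f y)]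
        linear_combination -this

end Bialgebra


/-! ### The Temperley-Lieb action on `V(2, r)^{⊗k}` -/

section Main

variable {𝕜 : Type*} [Field 𝕜] {n : ℕ} {q : 𝕜}

theorem V2_gen_apply [n.AtLeastTwo] (hq : IsPrimitiveRoot q n) (r : ZMod n) (x : Gen)
    (u : Fin 2 → 𝕜) (d : Fin 2) :
    V2 hq r (D.gen hq x) u d = matGen q r x d 0 * u 0 + matGen q r x d 1 * u 1 := by
  have : V2 hq r (D.gen hq x) = Matrix.toLin' (matGen q r x) := by
    simp only [V2, AlgHom.comp_apply, D.lift_gen]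
    rfl
  rw [this, Matrix.toLin'_apply, Matrix.mulVec, dotProduct, Fin.sum_univ_two]

theorem D.comul_gen [n.AtLeastTwo] (hq : IsPrimitiveRoot q n) (x : Gen) :
    Bialgebra.comulAlgHom 𝕜 (D hq) (D.gen hq x) = D.comulGen hq x :=
  D.lift_gen hq _ (D.sat_comulGen hq) x

/-- `D_n` is generated by `a`, `b`, `c`, `d`. -/
theorem D.mem_of_gen_mem (hq : IsPrimitiveRoot q n) (S : Subalgebra 𝕜 (D hq))
    (h : ∀ x, D.gen hq x ∈ S) (y : D hq) : y ∈ S := by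
  obtain ⟨z, rfl⟩ := RingQuot.mkAlgHom_surjective 𝕜 (DRel n q) y
  induction z using FreeAlgebra.induction with
  | grade0 c =>
    rw [AlgHom.commutes]
    exact S.algebraMap_mem c
  | grade1 x => exact h x
  | mul a b ha hb =>
    rw [map_mul]
    exact S.mul_mem ha hb
  | add a b ha hb =>
    rw [map_add]
    exact S.add_mem ha hb

theorem adjSite_comm_coordRep_V2 [n.AtLeastTwo] (hq : IsPrimitiveRoot q n) {p : 𝕜}
    (hp : p ^ 2 = q) (r : ZMod n) (k m : ℕ) (x : D hq) :
    Commute (adjSite k ![-p⁻¹, -p] ![p⁻¹ * qpow q (-r), p * qpow q r] m)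
      (coordRep (V2 hq r) k x) := by
  have q0 : q ≠ 0 := hq.ne_zero (NeZero.ne n)
  have p0 : p ≠ 0 := by rintro rfl; exact q0 (by simpa using hp.symm)
  have hr := qpow_ne_zero hq r
  have e1 : qpow q (r + 1) = qpow q r * q := by rw [qpow_add hq, qpow_one]
  have e2 : qpow q (-r) = (qpow q r)⁻¹ := qpow_neg hq r
  have e3 : qpow q (-(r + 1)) = (qpow q r)⁻¹ * q⁻¹ := by rw [qpow_neg hq, e1, mul_inv]
  refine D.mem_of_gen_mem hq ((Subalgebra.centralizer 𝕜
    {adjSite k ![-p⁻¹, -p] ![p⁻¹ * qpow q (-r), p * qpow q r] m}).comap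
      (coordRep (V2 hq r) k)) ?_ x _ rfl
  intro x
  rw [Subalgebra.mem_comap, Subalgebra.mem_centralizer_iff]
  rintro _ rfl
  refine LinearMap.ext fun v => Eq.symm ?_
  rw [Module.End.mul_apply, Module.End.mul_apply]
  cases x with
  | a =>
    refine adjSite_comm_coordRep (g := D.gen hq .b) (x' := D.gen hq .a)
      (G := ![qpow q r, qpow q (r + 1)]) (X := matGen q r .a) (D.comul_gen hq .a) ?_
      (V2_gen_apply hq r .a) ?_ k m v
    · intro u d
      rw [V2_gen_apply]
      fin_cases d <;> simp [matGen]
    · intro f t δ ht hδ c d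
      simp only [ht, hδ, matGen, e1, e2]
      generalize qpow q r = z at hr
      fin_cases c <;> fin_cases d <;> simp [← hp] <;> field_simp <;> ring
  | b =>
    -- A grouplike element fits the skew-primitive pattern with zero second term.
    refine adjSite_comm_coordRep (g := D.gen hq .b) (x' := 0)
      (G := ![qpow q r, qpow q (r + 1)]) (X := 0) ((D.comul_gen hq .b).trans (by simp [D.comulGen]))
      ?_ (by simp) ?_ k m v
    · intro u d
      rw [V2_gen_apply]
      fin_cases d <;> simp [matGen]
    · intro f t δ ht hδ c d
      simp [ht, hδ]
  | c =>
    refine adjSite_comm_coordRep (g := D.gen hq .c) (x' := 0)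
      (G := ![qpow q (-(r + 1)), qpow q (-r)]) (X := 0)
      ((D.comul_gen hq .c).trans (by simp [D.comulGen])) ?_ (by simp) ?_ k m v
    · intro u d
      rw [V2_gen_apply]
      fin_cases d <;> simp [matGen]
    · intro f t δ ht hδ c d
      simp [ht, hδ]
  | d =>
    refine adjSite_comm_coordRep (g := D.gen hq .c) (x' := D.gen hq .d)
      (G := ![qpow q (-(r + 1)), qpow q (-r)]) (X := matGen q r .d) (D.comul_gen hq .d) ?_
      (V2_gen_apply hq r .d) ?_ k m v
    · intro u d
      rw [V2_gen_apply]
      fin_cases d <;> simp [matGen]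
    · intro f t δ ht hδ c d
      simp only [ht, hδ, matGen, e3, e2]
      generalize qpow q r = z at hr
      fin_cases c <;> fin_cases d <;> simp [← hp] <;> field_simp <;> ring

/-! ### Spanning set and universal property of the Temperley–Lieb algebra -/

/-- The generators of `TL_k(ξ)`, indexed by natural numbers. -/
noncomputable def tlGen (k : ℕ) (ξ : 𝕜) (m : ℕ) : TL k ξ :=
  if h : m < k - 1 then TL.t k ξ ⟨m, h⟩ else 0

theorem tlSat_tlGen (k : ℕ) (ξ : 𝕜) : TLSat ξ (k - 1) (tlGen k ξ) := by
  have key : ∀ {x y}, TLRel k ξ x y →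
      RingQuot.mkAlgHom 𝕜 (TLRel k ξ) x = RingQuot.mkAlgHom 𝕜 (TLRel k ξ) y :=
    fun h => RingQuot.mkAlgHom_rel 𝕜 h
  have up : ∀ i j : Fin (k - 1), (j : ℕ) = i + 1 →
      TL.t k ξ i * TL.t k ξ j * TL.t k ξ i = TL.t k ξ i := fun i j h => by
    simpa [TL.t] using key (.triple i j h)
  constructor
  · intro a b h
    unfold tlGen
    split_ifs
    · simpa [TL.t] using key (.comm _ _ (Or.inl h))
    all_goals simp
  · intro a
    unfold tlGen
    split_ifs
    · simpa [TL.t] using key (.sq _)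
    · simp
  · intro a h
    unfold tlGen
    rw [dif_pos (by omega), dif_pos h]
    exact up _ _ rfl
  · intro a h
    unfold tlGen
    rw [dif_pos h, dif_pos (show a < k - 1 by omega)]
    have h1 := up ⟨a, by omega⟩ ⟨a + 1, h⟩ rfl
    -- The presentation has only one of the two triple relations; the braid relation transfers it to
    -- the other.
    have h2 := key (.braid ⟨a, by omega⟩ ⟨a + 1, h⟩ rfl)
    simp only [map_sub, map_mul] at h2
    change TL.t k ξ _ * TL.t k ξ _ * TL.t k ξ _ - TL.t k ξ _ =
      TL.t k ξ _ * TL.t k ξ _ * TL.t k ξ _ - TL.t k ξ _ at h2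
    rw [h1, sub_self] at h2
    exact sub_eq_zero.mp h2.symm

theorem span_wordProd_tlGen (k : ℕ) (ξ : 𝕜) : Submodule.span 𝕜 (Set.range
    fun L : {L : List (ℕ × ℕ) // IsJones L ∧ ∀ x ∈ L, x.1 < k - 1} =>
      wordProd (tlGen k ξ) (jonesWord L.1)) = ⊤ := by
  rw [eq_top_iff]
  rintro x -
  have hw : x ∈ Submodule.span 𝕜 (Set.range fun w : {w : List ℕ // ∀ a ∈ w, a < k - 1} =>
      wordProd (tlGen k ξ) w.1) := by
    obtain ⟨z, rfl⟩ := RingQuot.mkAlgHom_surjective 𝕜 (TLRel k ξ) x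
    induction z using FreeAlgebra.induction with
    | grade0 c =>
      rw [AlgHom.commutes, Algebra.algebraMap_eq_smul_one]
      exact Submodule.smul_mem _ _ (Submodule.subset_span ⟨⟨[], by simp⟩, rfl⟩)
    | grade1 i =>
      exact Submodule.subset_span ⟨⟨[i], by simp⟩, by simp [tlGen, TL.t]⟩
    | mul a b ha hb =>
      rw [map_mul]
      have hab := Submodule.mul_mem_mul ha hb
      rw [Submodule.span_mul_span] at hab
      refine Submodule.span_mono ?_ hab
      rintro _ ⟨_, ⟨v, rfl⟩, _, ⟨w, rfl⟩, rfl⟩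
      refine ⟨⟨v.1 ++ w.1, fun a ha => ?_⟩, wordProd_append _ _ _⟩
      exact (List.mem_append.mp ha).elim (v.2 a) (w.2 a)
    | add a b ha hb =>
      rw [map_add]
      exact Submodule.add_mem _ ha hb
  refine Submodule.span_le.mpr ?_ hw
  rintro _ ⟨w, rfl⟩
  exact (tlSat_tlGen k ξ).wordProd_mem_span w.1 w.2

/-- The universal property of `TL_k(ξ)`. -/
noncomputable def TL.lift {k : ℕ} {ξ : 𝕜} {A : Type*} [Ring A] [Algebra 𝕜 A] (f : ℕ → A)
    (hf : TLSat ξ (k - 1) f) : TL k ξ →ₐ[𝕜] A :=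
  RingQuot.liftAlgHom 𝕜 (s := TLRel k ξ)
    ⟨FreeAlgebra.lift 𝕜 fun i : Fin (k - 1) => f i, by
      intro x y h
      cases h with
      | comm i j h =>
        simp only [map_mul, FreeAlgebra.lift_ι_apply]
        exact h.elim (hf.comm _ _) fun h => (hf.comm _ _ h).symm
      | braid i j h =>
        have := j.2
        simp only [map_mul, map_sub, FreeAlgebra.lift_ι_apply, h]
        rw [hf.up _ (by omega), hf.down _ (by omega), sub_self, sub_self]
      | sq i => simp only [map_mul, map_smul, FreeAlgebra.lift_ι_apply, hf.sq]
      | triple i j h =>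
        have := j.2
        simp only [map_mul, FreeAlgebra.lift_ι_apply, h]
        exact hf.up _ (by omega)⟩

theorem TL.lift_t {k : ℕ} {ξ : 𝕜} {A : Type*} [Ring A] [Algebra 𝕜 A] (f : ℕ → A)
    (hf : TLSat ξ (k - 1) f) (i : Fin (k - 1)) : TL.lift f hf (TL.t k ξ i) = f i := by
  unfold TL.lift TL.t
  rw [RingQuot.liftAlgHom_mkAlgHom_apply]
  simp

/-- `TL_k(ξ)` is generated by the `t_i`. -/
theorem TL.mem_of_t_mem {k : ℕ} {ξ : 𝕜} (S : Subalgebra 𝕜 (TL k ξ)) (h : ∀ i, TL.t k ξ i ∈ S)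
    (y : TL k ξ) : y ∈ S := by
  obtain ⟨z, rfl⟩ := RingQuot.mkAlgHom_surjective 𝕜 (TLRel k ξ) y
  induction z using FreeAlgebra.induction with
  | grade0 c =>
    rw [AlgHom.commutes]
    exact S.algebraMap_mem c
  | grade1 x => exact h x
  | mul a b ha hb =>
    rw [map_mul]
    exact S.mul_mem ha hb
  | add a b ha hb =>
    rw [map_add]
    exact S.add_mem ha hb

theorem TL.lift_wordProd {k : ℕ} {ξ : 𝕜} {A : Type*} [Ring A] [Algebra 𝕜 A] (f : ℕ → A)
    (hf : TLSat ξ (k - 1) f) {w : List ℕ} (hw : ∀ a ∈ w, a < k - 1) :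
    TL.lift f hf (wordProd (tlGen k ξ) w) = wordProd f w := by
  induction w with
  | nil => simp
  | cons a w ih =>
    simp only [List.mem_cons, forall_eq_or_imp] at hw
    rw [wordProd_cons, wordProd_cons, map_mul, ih hw.2, tlGen, dif_pos hw.1, TL.lift_t]

/-- The Temperley-Lieb algebra acts faithfully in coordinates. -/
theorem TL.lift_adjSite_injective {k : ℕ} {A B : Fin 2 → 𝕜} (hA : A 0 * A 1 = 1)
    (hB : B 0 * B 1 = 1) :
    Function.Injective (TL.lift (adjSite k A B) (tlSat_adjSite (k := k) hA hB)) := by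
  rw [injective_iff_map_eq_zero]
  intro x hx
  have hx' : x ∈ Submodule.span 𝕜 (Set.range
      fun L : {L : List (ℕ × ℕ) // IsJones L ∧ ∀ x ∈ L, x.1 < k - 1} =>
        wordProd (tlGen k (A 0 + A 1)) (jonesWord L.1)) := by
    rw [span_wordProd_tlGen]
    trivial
  obtain ⟨c, rfl⟩ := Finsupp.mem_span_range_iff_exists_finsupp.mp hx'
  have h0 := linearIndependent_iff.mp (linearIndependent_jones (k := k) (A := A)
    (right_ne_zero_of_mul_eq_one hB)) c
  rw [h0, Finsupp.sum_zero_index]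
  rw [Finsupp.linearCombination_apply, ← hx, Finsupp.sum, Finsupp.sum, map_sum]
  refine Finset.sum_congr rfl fun L _ => ?_
  rw [map_smul, TL.lift_wordProd]
  intro a ha
  obtain ⟨x, hx, h1, h2⟩ := mem_jonesWord.mp ha
  exact h2.trans_lt (L.2.2 x hx)

end Main

end TaftTL

/-! ### The faithful action -/

theorem theorem4p3 {𝕜 : Type*} [Field 𝕜] [IsAlgClosed 𝕜] [CharZero 𝕜]
    (n : ℕ) [n.AtLeastTwo] (q : 𝕜) (hq : IsPrimitiveRoot q n)
    (p : 𝕜) (hp : p ^ 2 = q) (r : ZMod n) (k : ℕ) (hk : 2 ≤ k) :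
    ∃ π : TaftTL.TL k (-(p + p⁻¹)) →ₐ[𝕜]
        TaftTL.endAlg (TaftTL.powRep (TaftTL.V2 hq r) k),
      (∀ i : Fin (k - 1),
        (π (TaftTL.TL.t k (-(p + p⁻¹)) i) : Module.End 𝕜 (TensorPower 𝕜 k (Fin 2 → 𝕜))) =
          p • ((TaftTL.qpow q (-(r * (r + 1))))⁻¹ •
            TaftTL.checkR (TaftTL.V2 hq r) (TaftTL.Rmatrix hq) k i - 1)) ∧
      Function.Injective π := by
  have q0 : q ≠ 0 := hq.ne_zero (NeZero.ne n)
  have p0 : p ≠ 0 := by rintro rfl; exact q0 (by simpa using hp.symm)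
  set A : Fin 2 → 𝕜 := ![-p⁻¹, -p] with hA
  set B : Fin 2 → 𝕜 := ![p⁻¹ * TaftTL.qpow q (-r), p * TaftTL.qpow q r] with hB
  have hA1 : A 0 * A 1 = 1 := by simp [hA, p0]
  have hB1 : B 0 * B 1 = 1 := by
    have := TaftTL.qpow_ne_zero hq r
    simp only [hB, Matrix.cons_val_zero, Matrix.cons_val_one, TaftTL.qpow_neg hq]
    field_simp
  have hξ : -(p + p⁻¹) = A 0 + A 1 := by simp [hA]
  let e := (TaftTL.coords 𝕜 k).symm.conjAlgEquiv 𝕜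
  rw [hξ]
  have hmem : ∀ x, e (TaftTL.TL.lift (TaftTL.adjSite k A B)
      (TaftTL.tlSat_adjSite hA1 hB1) x) ∈ TaftTL.endAlg (TaftTL.powRep (TaftTL.V2 hq r) k) := by
    intro x
    rw [TaftTL.endAlg, Subalgebra.mem_centralizer_iff]
    rintro _ ⟨y, rfl⟩
    -- For fixed `y`, the elements whose image commutes with the action of `y` form a subalgebra, so
    -- the generators suffice.
    have hc := TaftTL.TL.mem_of_t_mem ((Subalgebra.centralizer 𝕜
      {TaftTL.coordRep (TaftTL.V2 hq r) k y}).comap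
        (TaftTL.TL.lift (TaftTL.adjSite k A B) (TaftTL.tlSat_adjSite hA1 hB1))) (fun i => by
      rw [Subalgebra.mem_comap, TaftTL.TL.lift_t, Subalgebra.mem_centralizer_iff]
      rintro _ rfl
      exact (TaftTL.adjSite_comm_coordRep_V2 hq hp r k i y).symm) x _ rfl
    have he : e (TaftTL.coordRep (TaftTL.V2 hq r) k y) = TaftTL.powRep (TaftTL.V2 hq r) k y := by
      refine LinearMap.ext fun t => ?_
      simp [e, LinearEquiv.conjAlgEquiv_apply, TaftTL.coordRep_coords]
    rw [← he, ← map_mul, ← map_mul]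
    exact congrArg e hc
  refine ⟨(e.toAlgHom.comp (TaftTL.TL.lift (TaftTL.adjSite k A B)
      (TaftTL.tlSat_adjSite hA1 hB1))).codRestrict _ hmem, ?_, ?_⟩
  · intro i
    refine LinearMap.ext fun t => (TaftTL.coords 𝕜 k).injective ?_
    rw [TaftTL.coords_checkR hq hp]
    change TaftTL.coords 𝕜 k (e (TaftTL.TL.lift _ _ _) t) = _
    rw [TaftTL.TL.lift_t]
    simp [e, LinearEquiv.conjAlgEquiv_apply, hA, hB]
  · intro x y hxy
    refine TaftTL.TL.lift_adjSite_injective hA1 hB1 (e.injective ?_)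
    exact congrArg Subtype.val hxy
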